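/- **Setting.** Let $n,t\ge 0$ be integers with $n>3t$, let $\mathbb F$ be a finite field, and let $\alpha_1,\dots,\alpha_n\in\mathbb F$ be distinct and non-zero. Parties $P_1,\dots,P_n$, one of which is the dealer $D$, are connected by pairwise private authentic channels and a broadcast channel and proceed in synchronous rounds. A static, computationally unbounded, possibly randomized and rushing adversary controls a set $\mathcal C$ of at most $t$ parties, which deviate arbitrarily. Degree-$t$ means $\sum_{k\le t}a_kx^k$, and degree-$(t,t)$ means $\sum_{i,j\le t}r_{ij}x^iy^j$. **Shamir's $t$-out-of-$n$ scheme.** Share $i$ of $s\in\mathbb F$ is $q(\alpha_i)$ for a uniformly random degree-$t$ polynomial $q$ with $q(0)=s$; recovery from $t+1$ shares is by interpolation. **Sharing protocol (7 rounds).** 1. $D$, on input $s$, picks a random degree-$t$ polynomial $q$ with $q(0)=s$ and a random degree-$(t,t)$ polynomial $F$ with $F(0,y)=q(y)$, and sends $f_i(x)=F(x,\alpha_i)$ and $g_i(y)=F(\alpha_i,y)$ to each $P_i$. 2. Each $P_i$ sends $f_{ij}=f_i(\alpha_j)$ to each $P_j$. 3. Each $P_i$ broadcasts the list $L_i$ of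 all $P_j$ with $f_{ji}\ne g_i(\alpha_j)$. 4. For each $P_j\in L_i$, $D$ broadcasts $F(\alpha_i,\alpha_j)$. 5. $P_i$ broadcasts an accusation of $D$ if $|L_i|>t$, or $P_i\in L_i$, or $P_i\in L_k$ and the value broadcast as $F(\alpha_k,\alpha_i)$ is not $f_i(\alpha_k)$ for some $k$, or the value broadcast as $F(\alpha_i,\alpha_j)$ is not $g_i(\alpha_j)$ for some $P_j\in L_i$. 6. For every $P_i$ that accused in round 5, $D$ broadcasts $f_i$ and $g_i$. 7. $P_i$ broadcasts an accusation if, for some $j$, $D$ has broadcast polynomials $f_j,g_j$ with $f_j(\alpha_i)\ne g_i(\alpha_j)$ or $g_j(\alpha_i)\ne f_i(\alpha_j)$, where $f_i,g_i$ are the polynomials $P_i$ received in round 1. Output: $D$ is discarded if it left a complaint (round 4) or a first-stage accusation (round 6) unanswered, or if more than $t$ parties accused it in round 5 or 7; then all shares are $0$. Otherwise the share of $P_i$ is $f_i(0)$, where polynomials broadcast for $P_i$ in round 6 replace those of round 1. A missing or malformed message of rounds 1–3, or of the reconstruction, is replaced by a default (zero polynomials, $0$, the empty list); in round 5, an unanswered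 complaint counts as a mismatch. **Reconstruction protocol (1 round).** Each $P_i$ sends its share to every party, and outputs the constant term of the degree-$t$ polynomial that disagrees with at most $t$ of the $n$ received values (Reed–Solomon decoding). **Theorem.** (a) This pair of protocols is a Type-II perfectly-secure VSS scheme with respect to Shamir's scheme, which is a $t$-out-of-$n$ secret-sharing scheme (any $t+1$ shares recover the secret; the distribution of any $t$ shares does not depend on it). That is, for every $\mathcal C$ with $|\mathcal C|\le t$: - *Privacy.* If $D\notin\mathcal C$, the distribution of the adversary's view of the sharing protocol does not depend on $s$. - *Correctness.* If $D\notin\mathcal C$, then in every execution, at the end of the sharing protocol the shares of the honest parties are Shamir shares of $s$ (for some degree-$t$ polynomial), and all honest parties output $s$ in the reconstruction. - *Strong commitment.* Even if $D\in\mathcal C$, in every execution of the sharing protocol the joint view of the honest parties determines a value $s^\star\in\mathbb F$ such that the shares of the honest parties are Shamir shares of $s^\star$ and all honest parties output $s^\star$ in the reconstruction, whatever the adversary does. (b) In every execution in which $D$ (honest or corrupt) is not discarded, at least $t+1$ honest parties never accuse $D$; the row- and column-polynomials that these received in round 1 lie on exactly one degree-$(t,t)$ polynomial $F^\star$ (that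 is, $f_i(x)=F^\star(x,\alpha_i)$ and $g_i(y)=F^\star(\alpha_i,y)$); the final polynomials of all honest parties lie on $F^\star$, the share of every honest $P_i$ is $F^\star(0,\alpha_i)$, and all honest parties reconstruct $F^\star(0,0)$. (c) There is an absolute constant $K$ such that in every execution of the two protocols the honest parties together send at most $K n^2\log_2|\mathbb F|$ bits over the point-to-point channels and broadcast at most $K n^2\log_2|\mathbb F|$ bits. Here each message of a round is encoded by a fixed-length binary string of length $\lceil\log_2(|M|+1)\rceil$, where $M$ is the finite set of possible messages of that kind in that round, and sending nothing costs nothing. -/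

import Mathlib

universe u

/-! ## Synchronous protocols with private channels and a broadcast channel -/

namespace SyncNet

/-- What one party sends in one round: an optional private message to every party, and an
optional broadcast. The value `none` means that nothing (or nothing well-formed) is sent. -/
structure Outgoing (n : ℕ) (P B : Type u) where
  priv : Fin n → Option P
  bc : Option B

/-- What one party receives in one round: `priv j` from party `j` over the private channel,
`bc j` broadcast by party `j`. -/
structure Incoming (n : ℕ) (P B : Type u) where
  priv : Fin n → Option P
  bc : Fin n → Option B

/-- The view of a party: its input, its random coins and all the messages received.
In the view held before round `r`, the entries of the rounds `≥ r` are empty. -/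
structure View (n rounds : ℕ) (P B : Fin rounds → Type u) (In Coins : Type u) where
  input : In
  coins : Coins
  recv : ∀ r, Incoming n (P r) (B r)

/-- A synchronous `n`-party protocol. The messages of round `r` come from the finite sets `PMsg r`
(private) and `BMsg r` (broadcast). The messages of party `i` in round `r` are determined by its
input, its (uniformly random) coins and the messages it received in previous rounds. -/
structure Protocol (n : ℕ) (In Out : Type u) where
  rounds : ℕ
  PMsg : Fin rounds → Type u
  BMsg : Fin rounds → Type u
  finitePMsg : ∀ r, Finite (PMsg r)
  finiteBMsg : ∀ r, Finite (BMsg r)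
  Coins : Type u
  fintypeCoins : Fintype Coins
  nonemptyCoins : Nonempty Coins
  send : (r : Fin rounds) → Fin n → View n rounds PMsg BMsg In Coins →
    Outgoing n (PMsg r) (BMsg r)
  output : Fin n → View n rounds PMsg BMsg In Coins → Out

namespace Protocol

attribute [instance] Protocol.finitePMsg Protocol.finiteBMsg Protocol.fintypeCoins
  Protocol.nonemptyCoins

variable {n : ℕ} {In Out : Type u} (Q : Protocol n In Out)

/-- The views of a party in an execution of `Q`. -/
abbrev PartyView : Type u := View n Q.rounds Q.PMsg Q.BMsg In Q.Coins

/-- All messages sent in an execution, indexed by round and sender. -/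
abbrev Transcript : Type u :=
  (r : Fin Q.rounds) → Fin n → Outgoing n (Q.PMsg r) (Q.BMsg r)

/-- The view of party `i` under the transcript `τ`. -/
def view (x : Fin n → In) (c : Fin n → Q.Coins) (τ : Q.Transcript) (i : Fin n) : Q.PartyView where
  input := x i
  coins := c i
  recv r := { priv := fun j => (τ r j).priv i, bc := fun j => (τ r j).bc }

/-- A strategy of an adversary who controls the set `C` of corrupt parties: in every round
it chooses all the messages of the corrupt parties, as an arbitrary function of the views of the
corrupt parties. It is rushing: when it is asked in round `r`, these views already contain the
messages of round `r` that the honest parties broadcast or send to the corrupt parties. -/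
def Strategy (C : Finset (Fin n)) : Type u :=
  (r : Fin Q.rounds) → ({i // i ∈ C} → Q.PartyView) →
    {i // i ∈ C} → Outgoing n (Q.PMsg r) (Q.BMsg r)

/-- The messages of round `r`, when `τ` holds the messages of the rounds before `r`. -/
def step (C : Finset (Fin n)) (A : Q.Strategy C) (x : Fin n → In) (c : Fin n → Q.Coins)
    (r : Fin Q.rounds) (τ : Q.Transcript) : Fin n → Outgoing n (Q.PMsg r) (Q.BMsg r) :=
  let honest : Fin n → Outgoing n (Q.PMsg r) (Q.BMsg r) := fun i =>
    if i ∈ C then ⟨fun _ => none, none⟩ else Q.send r i (Q.view x c τ i)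
  fun i =>
    if h : i ∈ C then A r (fun j => Q.view x c (Function.update τ r honest) j) ⟨i, h⟩
    else honest i

/-- The transcript of the first `k` rounds (later rounds are empty). -/
def run (C : Finset (Fin n)) (A : Q.Strategy C) (x : Fin n → In) (c : Fin n → Q.Coins) :
    ℕ → Q.Transcript
  | 0 => fun _ _ => ⟨fun _ => none, none⟩
  | k + 1 =>
    if h : k < Q.rounds then
      Function.update (run C A x c k) ⟨k, h⟩ (Q.step C A x c ⟨k, h⟩ (run C A x c k))
    else run C A x c k

/-- The transcript of the complete execution. -/
def exec (C : Finset (Fin n)) (A : Q.Strategy C) (x : Fin n → In) (c : Fin n → Q.Coins) :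
    Q.Transcript :=
  Q.run C A x c Q.rounds

/-- The views of all parties at the end of the execution. -/
def finalView (C : Finset (Fin n)) (A : Q.Strategy C) (x : Fin n → In) (c : Fin n → Q.Coins) :
    Fin n → Q.PartyView :=
  Q.view x c (Q.exec C A x c)

/-- The outputs of the parties (meaningful for the honest ones, those outside `C`). -/
def result (C : Finset (Fin n)) (A : Q.Strategy C) (x : Fin n → In) (c : Fin n → Q.Coins)
    (i : Fin n) : Out :=
  Q.output i (Q.finalView C A x c i)

/-- The number of bits of a message from the finite set `M`, under a fixed-length binary encoding
of `M` that has one spare code word. -/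
noncomputable def msgBits (M : Type u) : ℕ := Nat.clog 2 (Nat.card M + 1)

/-- The number of bits sent by the honest parties over the point-to-point channels. -/
noncomputable def privBits (C : Finset (Fin n)) (τ : Q.Transcript) : ℕ :=
  ∑ r, ∑ i ∈ Cᶜ, ∑ j, if ((τ r i).priv j).isSome then msgBits (Q.PMsg r) else 0

/-- The number of bits broadcast by the honest parties. -/
noncomputable def bcBits (C : Finset (Fin n)) (τ : Q.Transcript) : ℕ :=
  ∑ r, ∑ i ∈ Cᶜ, if ((τ r i).bc).isSome then msgBits (Q.BMsg r) else 0

end Protocol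

end SyncNet

/-! ## Secret sharing and verifiable secret sharing -/

/-- The syntax of a secret-sharing scheme: the share-generation function (with uniform randomness)
and the recovery function, which is applied to the shares of a set of indices. -/
structure SecretSharing (n : ℕ) (S Share : Type u) where
  Rand : Type u
  fintypeRand : Fintype Rand
  nonemptyRand : Nonempty Rand
  gen : S → Rand → Fin n → Share
  recover : (I : Finset (Fin n)) → ({i // i ∈ I} → Share) → S

namespace SecretSharing

attribute [instance] SecretSharing.fintypeRand SecretSharing.nonemptyRand

variable {n : ℕ} {S Share : Type u} (Pi : SecretSharing n S Share)

/-- `t`-out-of-`n` secret sharing. -/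
def IsThreshold (t : ℕ) : Prop :=
  (∀ (s : S) (q : Pi.Rand) (I : Finset (Fin n)), I.card = t + 1 →
      Pi.recover I (fun i => Pi.gen s q i) = s) ∧
  (∀ (I : Finset (Fin n)), I.card = t → ∀ s s' : S,
      (PMF.uniformOfFintype Pi.Rand).map (fun q (i : {i // i ∈ I}) => Pi.gen s q i) =
        (PMF.uniformOfFintype Pi.Rand).map (fun q (i : {i // i ∈ I}) => Pi.gen s' q i))

/-- The value `s` is secret-shared as per `Pi`, where `share i` is the share held by party `i`
and the parties outside `C` are honest. -/
def IsSharing (C : Finset (Fin n)) (s : S) (share : Fin n → Share) : Prop :=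
  ∃ q : Pi.Rand, ∀ i, i ∉ C → share i = Pi.gen s q i

end SecretSharing

/-- A pair of protocols: a sharing protocol, whose outputs are the shares, and a
reconstruction protocol, in which the input of every party is its view of the sharing protocol. -/
structure VSSScheme (n : ℕ) (S Share : Type u) where
  sh : SyncNet.Protocol n (Option S) Share
  recon : SyncNet.Protocol n sh.PartyView S

namespace VSSScheme

variable {n : ℕ} {S Share : Type u} (V : VSSScheme n S Share)

/-- The inputs for the sharing protocol: only the dealer `D` has one. -/
def inputs (D : Fin n) (s : S) : Fin n → Option S := fun i => if i = D then some s else none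

/-- The distribution of the adversary's view in the sharing protocol: the adversary's own
random tape together with the views of the corrupt parties. -/
noncomputable def advView (D : Fin n) (C : Finset (Fin n)) {Tape : Type} (tape : PMF Tape)
    (A : Tape → V.sh.Strategy C) (s : S) : PMF (Tape × ({i // i ∈ C} → V.sh.PartyView)) :=
  (PMF.uniformOfFintype (Fin n → V.sh.Coins)).bind fun c =>
    tape.map fun w => (w, fun i => V.sh.finalView C (A w) (inputs D s) c i)

/-- If the dealer is honest, the view of the (randomized) adversary in the sharing protocol is
distributed independently of the secret. -/
def Privacy (D : Fin n) (t : ℕ) : Prop :=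
  ∀ C : Finset (Fin n), C.card ≤ t → D ∉ C →
    ∀ (Tape : Type) (tape : PMF Tape) (A : Tape → V.sh.Strategy C) (s s' : S),
      V.advView D C tape A s = V.advView D C tape A s'

/-- If the dealer is honest, then in every execution `s` is secret-shared as per `Pi` at the end of
the sharing protocol, and all honest parties output `s` at the end of the reconstruction. -/
def Correctness (D : Fin n) (t : ℕ) (Pi : SecretSharing n S Share) : Prop :=
  ∀ C : Finset (Fin n), C.card ≤ t → D ∉ C →
    ∀ (s : S) (c : Fin n → V.sh.Coins) (A : V.sh.Strategy C),
      Pi.IsSharing C s (V.sh.result C A (inputs D s) c) ∧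
      ∀ (c' : Fin n → V.recon.Coins) (A' : V.recon.Strategy C), ∀ i, i ∉ C →
        V.recon.result C A' (V.sh.finalView C A (inputs D s) c) c' i = s

/-- Even if the dealer is corrupt, in every execution of the sharing protocol the joint view of the
honest parties defines a value (the value of `commit`), which is secret-shared as per `Pi`, and
which all honest parties output at the end of the reconstruction, whatever the adversary does. -/
def StrongCommitment (D : Fin n) (t : ℕ) (Pi : SecretSharing n S Share) : Prop :=
  ∀ C : Finset (Fin n), C.card ≤ t →
    ∃ commit : ({i // i ∉ C} → V.sh.PartyView) → S,
      ∀ (s : S) (c : Fin n → V.sh.Coins) (A : V.sh.Strategy C),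
        let views := V.sh.finalView C A (inputs D s) c
        let sStar := commit (fun i => views i)
        Pi.IsSharing C sStar (V.sh.result C A (inputs D s) c) ∧
        ∀ (c' : Fin n → V.recon.Coins) (A' : V.recon.Strategy C), ∀ i, i ∉ C →
          V.recon.result C A' views c' i = sStar

/-- Type-II perfectly-secure VSS with respect to the `t`-out-of-`n` secret-sharing scheme `Pi`, with
dealer `D` and at most `t` corrupt parties. -/
def IsTypeII (D : Fin n) (t : ℕ) (Pi : SecretSharing n S Share) : Prop :=
  Pi.IsThreshold t ∧ V.Privacy D t ∧ V.Correctness D t Pi ∧ V.StrongCommitment D t Pi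

end VSSScheme

/-! ## Polynomials, Shamir's scheme and Reed–Solomon decoding -/

namespace BGW

/-- Degree-`d` univariate polynomials `∑ a k * x ^ k`, `k ≤ d`. -/
abbrev Poly (F : Type u) (d : ℕ) : Type u := Fin (d + 1) → F

/-- Degree-`(d, d)` bivariate polynomials `∑ r i j * x ^ i * y ^ j`, `i, j ≤ d`. -/
abbrev Bivar (F : Type u) (d : ℕ) : Type u := Fin (d + 1) → Fin (d + 1) → F

section

variable {F : Type u} [Field F] {n d : ℕ}

/-- The value of a polynomial at `x`. -/
def ev (p : Poly F d) (x : F) : F := ∑ k, p k * x ^ (k : ℕ)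

/-- The value of a bivariate polynomial at `(x, y)`. -/
def ev₂ (R : Bivar F d) (x y : F) : F := ∑ i, ∑ j, R i j * x ^ (i : ℕ) * y ^ (j : ℕ)

/-- The polynomial `R(x, a)` in `x`. -/
def row (R : Bivar F d) (a : F) : Poly F d := fun i => ∑ j, R i j * a ^ (j : ℕ)

/-- The polynomial `R(a, y)` in `y`. -/
def col (R : Bivar F d) (a : F) : Poly F d := fun j => ∑ i, R i j * a ^ (i : ℕ)

/-- Shamir's `t`-out-of-`n` scheme: the secret is the constant term of a random degree-`t`
polynomial, share `i` is its value at `α i`, and recovery is by interpolation. -/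
noncomputable def shamir [Fintype F] (α : Fin n → F) (t : ℕ) : SecretSharing n F F where
  Rand := Fin t → F
  fintypeRand := inferInstance
  nonemptyRand := inferInstance
  gen s a i := ev (d := t) (Fin.cons s a) (α i)
  recover I y :=
    (Lagrange.interpolate (Finset.univ : Finset {i // i ∈ I}) (fun i => α i) y).eval 0

variable [DecidableEq F]

open Classical in
/-- Reed–Solomon decoding of the word `W` of (claimed) values at the points `α i`: the degree-`d`
polynomial that disagrees with `W` in at most `r` positions (unique if `d + 2 * r + 1 ≤ n` and the
points are distinct), and the zero polynomial if there is none. -/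
noncomputable def rsDec (α : Fin n → F) (d r : ℕ) (W : Fin n → F) : Poly F d :=
  if h : ∃ p : Poly F d, (Finset.univ.filter fun i => ev p (α i) ≠ W i).card ≤ r then h.choose
  else 0

end

/-! ## The sharing protocol -/

/-- Private messages: a pair of polynomials (first round), a field element (second round). -/
abbrev ShP (F : Type u) (t : ℕ) : Fin 7 → Type u
  | 0 => Poly F t × Poly F t
  | 1 => F
  | 2 | 3 | 4 | 5 | 6 => PEmpty

/-- Broadcasts: a complaint-list (third round), the disputed values (fourth round), an accusation
(fifth round), polynomials of accusing parties (sixth round), an accusation (seventh round). -/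
abbrev ShB (F : Type u) (n t : ℕ) : Fin 7 → Type u
  | 0 | 1 => PEmpty
  | 2 => ULift.{u} (Finset (Fin n))
  | 3 => Fin n → Fin n → Option F
  | 4 => PUnit
  | 5 => Fin n → Option (Poly F t × Poly F t)
  | 6 => PUnit

/-- The random choices of the dealer: the non-constant coefficients of the Shamir-sharing polynomial,
and the coefficients `r i j`, `1 ≤ i`, of the bivariate polynomial. -/
abbrev ShCoins (F : Type u) (t : ℕ) : Type u := (Fin t → F) × (Fin t → Fin (t + 1) → F)

abbrev ShView (F : Type u) (n t : ℕ) : Type u :=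
  SyncNet.View n 7 (ShP F t) (ShB F n t) (Option F) (ShCoins F t)

section

variable {F : Type u} [Field F] {n t : ℕ}

/-- The dealer's bivariate polynomial `R`, with `R(0, y) = q(y)` and `q(0) = s`. -/
def dealerPoly (v : ShView F n t) : Bivar F t :=
  Fin.cons (Fin.cons (v.input.getD 0) v.coins.1) v.coins.2

/-- The row- and column-polynomial received from the dealer `D` in the first round (by default, the
zero polynomials). -/
def received (D : Fin n) (v : ShView F n t) : Poly F t × Poly F t :=
  Option.getD (α := Poly F t × Poly F t) ((v.recv 0).priv D) (0, 0)

/-- The value received from party `j` in the second round (by default, `0`). -/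
def crossValue (v : ShView F n t) (j : Fin n) : F :=
  Option.getD (α := F) ((v.recv 1).priv j) 0

/-- The complaint-list broadcast by party `k` in the third round (by default, empty). -/
def complaints (v : ShView F n t) (k : Fin n) : Finset (Fin n) :=
  (Option.getD (α := ULift.{u} (Finset (Fin n))) ((v.recv 2).bc k) ⟨∅⟩).down

/-- The value that the dealer broadcast in the fourth round for the complaint of party `i` about
party `j`, if any. -/
def resolved (D : Fin n) (v : ShView F n t) (i j : Fin n) : Option F :=
  Option.bind (α := Fin n → Fin n → Option F) ((v.recv 3).bc D) fun m => m i j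

/-- The parties that broadcast an accusation in the fifth round. -/
def accusers₁ (v : ShView F n t) : Finset (Fin n) :=
  Finset.univ.filter fun k => ((v.recv 4).bc k).isSome

/-- The row- and column-polynomial that the dealer broadcast for party `k` in the sixth round. -/
def published (D : Fin n) (v : ShView F n t) (k : Fin n) : Option (Poly F t × Poly F t) :=
  Option.bind (α := Fin n → Option (Poly F t × Poly F t)) ((v.recv 5).bc D) fun m => m k

/-- The parties that broadcast an accusation in the fifth or in the seventh round. -/
def accusers (v : ShView F n t) : Finset (Fin n) :=
  accusers₁ v ∪ Finset.univ.filter fun k => ((v.recv 6).bc k).isSome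

/-- The dealer is discarded: it left a complaint or a first-stage accusation unanswered, or more
than `t` parties accused it. -/
def Discarded (D : Fin n) (v : ShView F n t) : Prop :=
  (∃ i j, j ∈ complaints v i ∧ resolved D v i j = none) ∨
  (∃ k ∈ accusers₁ v, published D v k = none) ∨
  t < (accusers v).card

/-- The polynomials of party `i` at the end: those broadcast for it in the sixth round, if any, and
otherwise those received in the first round. -/
def finalPolys (D i : Fin n) (v : ShView F n t) : Poly F t × Poly F t :=
  (published D v i).getD (received D v)

open Classical in
/-- The share of party `i` (`0`, if the dealer is discarded). -/
noncomputable def share (D i : Fin n) (v : ShView F n t) : F :=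
  if Discarded D v then 0 else ev (finalPolys D i v).1 0

variable [DecidableEq F] (α : Fin n → F)

/-- The complaint-list of a party: all `j` whose value is inconsistent with the party's own
column-polynomial. -/
def complaintList (D : Fin n) (v : ShView F n t) : Finset (Fin n) :=
  Finset.univ.filter fun j => crossValue v j ≠ ev (received D v).2 (α j)

/-- The conditions for party `i` to accuse the dealer in the fifth round. -/
def Accuses₁ (D i : Fin n) (v : ShView F n t) : Prop :=
  (t < (complaintList α D v).card ∨ i ∈ complaintList α D v) ∨
  (∃ k, i ∈ complaints v k ∧ resolved D v k i ≠ some (ev (received D v).1 (α k))) ∨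
  (∃ j ∈ complaintList α D v, resolved D v i j ≠ some (ev (received D v).2 (α j)))

/-- The condition for party `i` to accuse the dealer in the seventh round. -/
def Accuses₂ (D i : Fin n) (v : ShView F n t) : Prop :=
  ∃ j p, published D v j = some p ∧
    (ev p.1 (α i) ≠ ev (received D v).2 (α j) ∨ ev p.2 (α i) ≠ ev (received D v).1 (α j))

open Classical in
/-- The messages that party `i` sends in the seven rounds. -/
noncomputable def shSend (D : Fin n) : (r : Fin 7) → Fin n → ShView F n t →
    SyncNet.Outgoing n (ShP F t r) (ShB F n t r)
  | 0, i, v =>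
    { priv := fun j =>
        if i = D then some (row (dealerPoly v) (α j), col (dealerPoly v) (α j)) else none
      bc := none }
  | 1, _, v => { priv := fun j => some (ev (F := F) (received D v).1 (α j)), bc := none }
  | 2, _, v => { priv := fun _ => none, bc := some ⟨complaintList α D v⟩ }
  | 3, i, v =>
    { priv := fun _ => none
      bc :=
        if i = D then
          some fun k j =>
            if j ∈ complaints v k then some (ev₂ (dealerPoly v) (α k) (α j)) else none
        else none }
  | 4, i, v => { priv := fun _ => none, bc := if Accuses₁ α D i v then some ⟨⟩ else none }
  | 5, i, v =>
    { priv := fun _ => none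
      bc :=
        if i = D then
          some fun k =>
            if k ∈ accusers₁ v then
              some (row (dealerPoly v) (α k), col (dealerPoly v) (α k))
            else none
        else none }
  | 6, i, v => { priv := fun _ => none, bc := if Accuses₂ α D i v then some ⟨⟩ else none }

instance [Finite F] (r : Fin 7) : Finite (ShP F t r) := by
  fin_cases r <;> simp only [ShP] <;> infer_instance

instance [Finite F] (r : Fin 7) : Finite (ShB F n t r) := by
  fin_cases r <;> simp only [ShB] <;> infer_instance

variable [Fintype F]

/-- The seven-round sharing protocol, with dealer `D`. -/
noncomputable abbrev sharing (t : ℕ) (D : Fin n) : SyncNet.Protocol n (Option F) F where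
  rounds := 7
  PMsg := ShP F t
  BMsg := ShB F n t
  finitePMsg := inferInstance
  finiteBMsg := inferInstance
  Coins := ShCoins F t
  fintypeCoins := inferInstance
  nonemptyCoins := inferInstance
  send := shSend α D
  output := share D

/-- The one-round reconstruction protocol: every party sends its share to every party and decodes the
shares received (by default, `0`), correcting up to `t` errors. -/
noncomputable abbrev reconstruction (t : ℕ) (D : Fin n) :
    SyncNet.Protocol n (sharing α t D).PartyView F where
  rounds := 1
  PMsg _ := F
  BMsg _ := PEmpty
  finitePMsg := inferInstance
  finiteBMsg := inferInstance
  Coins := PUnit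
  fintypeCoins := inferInstance
  nonemptyCoins := inferInstance
  send _ i v := { priv := fun _ => some (share D i v.input), bc := none }
  output _ v := ev (rsDec α t t fun j => ((v.recv 0).priv j).getD 0) 0

/-- The scheme of Ben-Or, Goldwasser and Wigderson. -/
noncomputable abbrev scheme (t : ℕ) (D : Fin n) : VSSScheme n F F where
  sh := sharing α t D
  recon := reconstruction α t D

/-- In every execution in which the honest parties do not discard the dealer, at least `t + 1` honest
parties never accuse the dealer, the polynomials that these received in the first round lie on
exactly one degree-`(t, t)` bivariate polynomial `R`, the polynomials and shares of all honest
parties are derived from `R`, and all honest parties reconstruct `R(0, 0)`. -/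
def CommitsToBivariate (t : ℕ) (D : Fin n) : Prop :=
  ∀ C : Finset (Fin n), C.card ≤ t →
    ∀ (s : F) (c : Fin n → (scheme α t D).sh.Coins) (A : (scheme α t D).sh.Strategy C),
      let views : Fin n → ShView F n t :=
        (scheme α t D).sh.finalView C A (VSSScheme.inputs D s) c
      ∀ i₀, i₀ ∉ C → ¬ Discarded D (views i₀) →
        let H : Finset (Fin n) := Finset.univ.filter fun i => i ∉ C ∧ i ∉ accusers (views i₀)
        t + 1 ≤ H.card ∧
        ∃ R : Bivar F t,
          (∀ R' : Bivar F t,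
            (∀ i ∈ H, received D (views i) = (row R' (α i), col R' (α i))) ↔ R' = R) ∧
          (∀ i, i ∉ C → ¬ Discarded D (views i) ∧
            finalPolys D i (views i) = (row R (α i), col R (α i)) ∧
            (scheme α t D).sh.result C A (VSSScheme.inputs D s) c i = ev₂ R 0 (α i)) ∧
          ∀ (c' : Fin n → (scheme α t D).recon.Coins) (A' : (scheme α t D).recon.Strategy C),
            ∀ i, i ∉ C → (scheme α t D).recon.result C A' views c' i = ev₂ R 0 0

end

end BGW

/-! An honest message depends only on earlier rounds, so an execution can be replaced by equations
between the final views of the parties: `IsExecution` for any dealer, together with `HonestDealer`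
for an honest one. Apart from the counting of bits, the rest is algebra on these equations.

Commitment. If the dealer is not discarded, remove at most `t` corrupt parties and at most `t`
accusers: since `3 * t < n`, at least `t + 1` honest parties remain that never accuse. Any two of
them are consistent, because an inconsistency causes a complaint, and a single public answer cannot
match two different values. Pairwise consistent rows and columns at `t + 1` points lie on a unique
bivariate polynomial (`exists_bivar`, `bivar_ext`). The final pair of any honest party is consistent
with these `t + 1` parties, hence lies on the same polynomial (`IsExecution.exists_bivar`). If the
dealer is discarded, all shares are zero. In both cases the honest shares lie on one degree-`t`
polynomial, which decoding recovers despite `t` errors (`rsDec_eq`). With an honest dealer, honest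
parties neither complain about each other nor accuse, so this polynomial is the dealer's own.

Privacy. Some `z` has `z(0) = 1` and vanishes at the at most `t` corrupt points. Adding `(s' - s)
z(x) z(y)` to the dealer's polynomial turns the secret `s` into `s'` and changes no row or column of
a corrupt party. Whatever is later published about the polynomial concerns a corrupt row or column,
so round by round the adversary sees the same (`shSend_agree`). The change is a translation of the
dealer's coins, which preserves the uniform distribution.

Communication is bounded by counting messages round by round. -/

namespace SyncNet.Protocol

/-! ### Executions as fixed points of their own transcripts -/

variable {n : ℕ} {In Out : Type u} (Q : Protocol n In Out)

/-- The part of the transcript `τ` before round `r`; the other rounds are empty. -/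
def before (τ : Q.Transcript) (r : ℕ) : Q.Transcript := fun r' i =>
  if (r' : ℕ) < r then τ r' i else ⟨fun _ => none, none⟩

/-- The part of the transcript `τ` before round `r`, together with the messages that the parties
outside `C` send in round `r`. -/
def rushing (C : Finset (Fin n)) (τ : Q.Transcript) (r : Fin Q.rounds) : Q.Transcript :=
  Function.update (Q.before τ r) r fun i => if i ∈ C then ⟨fun _ => none, none⟩ else τ r i

variable (C : Finset (Fin n)) (A : Q.Strategy C) (x : Fin n → In) (c : Fin n → Q.Coins)

theorem run_succ {k : ℕ} (h : k < Q.rounds) :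
    Q.run C A x c (k + 1) =
      Function.update (Q.run C A x c k) ⟨k, h⟩ (Q.step C A x c ⟨k, h⟩ (Q.run C A x c k)) := by
  simp [run, h]

/-- Each round is written once, by the step at its own index: it is empty before that and never
altered afterwards. -/
theorem run_eq (k : ℕ) (hk : k ≤ Q.rounds) (r : Fin Q.rounds) :
    Q.run C A x c k r =
      if (r : ℕ) < k then Q.step C A x c r (Q.run C A x c r)
      else fun _ => ⟨fun _ => none, none⟩ := by
  induction k with
  | zero => simp [run]
  | succ k ih =>
    rw [run_succ Q C A x c (by omega)]
    by_cases h : r = ⟨k, by omega⟩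
    · subst h; simp
    · have h' : (r : ℕ) ≠ k := fun e => h (Fin.ext e)
      rw [Function.update_of_ne h, ih (by omega)]
      have : (r : ℕ) < k + 1 ↔ (r : ℕ) < k := by omega
      simp [this]

theorem exec_eq_step (r : Fin Q.rounds) :
    Q.exec C A x c r = Q.step C A x c r (Q.run C A x c r) := by
  rw [exec, run_eq Q C A x c _ le_rfl, if_pos r.2]

theorem run_eq_before (k : ℕ) (hk : k ≤ Q.rounds) :
    Q.run C A x c k = Q.before (Q.exec C A x c) k := by
  funext r i
  rw [run_eq Q C A x c k hk, before, exec_eq_step]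
  split_ifs <;> rfl

theorem exec_of_notMem (r : Fin Q.rounds) {i : Fin n} (hi : i ∉ C) :
    Q.exec C A x c r i = Q.send r i (Q.view x c (Q.before (Q.exec C A x c) r) i) := by
  rw [exec_eq_step, run_eq_before Q C A x c _ r.2.le]
  simp [step, hi]

/-- Rushing in closed form: what the adversary sees when it chooses round `r` is cut out of the
final transcript, with no reference to partial runs. -/
theorem exec_of_mem (r : Fin Q.rounds) {i : Fin n} (hi : i ∈ C) :
    Q.exec C A x c r i =
      A r (fun j => Q.view x c (Q.rushing C (Q.exec C A x c) r) j) ⟨i, hi⟩ := by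
  have : Q.rushing C (Q.exec C A x c) r = Function.update (Q.before (Q.exec C A x c) r) r
      fun i => if i ∈ C then ⟨fun _ => none, none⟩
        else Q.send r i (Q.view x c (Q.before (Q.exec C A x c) r) i) := by
    unfold rushing
    congr 1
    funext i
    split_ifs with h
    · rfl
    · rw [exec_of_notMem Q C A x c r h]
  rw [this, exec_eq_step, run_eq_before Q C A x c _ r.2.le]
  simp [step, hi]

/-- If the messages of the honest parties that are visible to corrupt parties agree in two
executions as soon as this was so in the earlier rounds, then so do all the messages apart from
those between honest parties. -/
theorem exec_agree {x x' : Fin n → In} {c c' : Fin n → Q.Coins}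
    (hx : ∀ i ∈ C, x i = x' i) (hc : ∀ i ∈ C, c i = c' i)
    (H : ∀ r : Fin Q.rounds,
      (∀ r' < r, ∀ i, (Q.exec C A x c r' i).bc = (Q.exec C A x' c' r' i).bc ∧
        ∀ j, i ∈ C ∨ j ∈ C →
          (Q.exec C A x c r' i).priv j = (Q.exec C A x' c' r' i).priv j) →
      ∀ i, i ∉ C → (Q.exec C A x c r i).bc = (Q.exec C A x' c' r i).bc ∧
        ∀ j, j ∈ C → (Q.exec C A x c r i).priv j = (Q.exec C A x' c' r i).priv j)
    (r : Fin Q.rounds) (i : Fin n) :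
    (Q.exec C A x c r i).bc = (Q.exec C A x' c' r i).bc ∧
      ∀ j, i ∈ C ∨ j ∈ C →
        (Q.exec C A x c r i).priv j = (Q.exec C A x' c' r i).priv j := by
  induction r using WellFoundedLT.induction generalizing i with
  | ind r ih =>
  have hon := H r ih
  by_cases hi : i ∈ C
  · have key : ∀ j ∈ C, Q.view x c (Q.rushing C (Q.exec C A x c) r) j =
        Q.view x' c' (Q.rushing C (Q.exec C A x' c') r) j := by
      intro j hj
      have hm : ∀ r' k,
          ((Q.rushing C (Q.exec C A x c) r) r' k).bc =
            ((Q.rushing C (Q.exec C A x' c') r) r' k).bc ∧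
          ((Q.rushing C (Q.exec C A x c) r) r' k).priv j =
            ((Q.rushing C (Q.exec C A x' c') r) r' k).priv j := by
        intro r' k
        unfold rushing
        -- In round `r` only honest senders are visible, which is `hon`; earlier rounds agree by
        -- induction and later ones are empty.
        by_cases h : r' = r
        · subst h
          by_cases hk : k ∈ C
          · simp [hk]
          · simpa [hk] using ⟨(hon k hk).1, (hon k hk).2 j hj⟩
        · simp only [Function.update_of_ne h, before]
          split_ifs with h'
          · exact ⟨(ih r' h' k).1, (ih r' h' k).2 j (Or.inr hj)⟩
          · simp
      simp only [view, hx j hj, hc j hj, hm]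
    have : Q.exec C A x c r i = Q.exec C A x' c' r i := by
      rw [exec_of_mem Q C A x c r hi, exec_of_mem Q C A x' c' r hi]
      congr 1
      funext j
      exact key j j.2
    simp [this]
  · refine ⟨(hon i hi).1, fun j hj => (hon i hi).2 j (hj.resolve_left hi)⟩

/-- Two executions give the corrupt parties the same views if this holds for their inputs and
coins, and if in every round the broadcasts of the honest parties and their messages to corrupt
parties agree as soon as all earlier messages agree, apart from those between honest parties. -/
theorem finalView_agree {x x' : Fin n → In} {c c' : Fin n → Q.Coins}
    (hx : ∀ i ∈ C, x i = x' i) (hc : ∀ i ∈ C, c i = c' i)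
    (H : ∀ r : Fin Q.rounds,
      (∀ r' < r, ∀ i k, ((Q.finalView C A x c i).recv r').bc k =
        ((Q.finalView C A x' c' i).recv r').bc k) →
      (∀ r' < r, ∀ i, ∀ k ∈ C, ((Q.finalView C A x c i).recv r').priv k =
        ((Q.finalView C A x' c' i).recv r').priv k) →
      ∀ i, i ∉ C → (Q.exec C A x c r i).bc = (Q.exec C A x' c' r i).bc ∧
        ∀ j ∈ C, (Q.exec C A x c r i).priv j = (Q.exec C A x' c' r i).priv j)
    {i : Fin n} (hi : i ∈ C) :
    Q.finalView C A x c i = Q.finalView C A x' c' i := by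
  have agree := Q.exec_agree C A hx hc fun r ih =>
    H r (fun r' hr' _ k => (ih r' hr' k).1) fun r' hr' i k hk => (ih r' hr' k).2 i (Or.inl hk)
  unfold finalView view
  simp only [hx i hi, hc i hi, fun r j => (agree r j).1,
    fun r j => (agree r j).2 i (Or.inr hi)]

end SyncNet.Protocol

/-! ### Univariate and bivariate polynomials -/

namespace BGW

section

variable {F : Type u} [Field F] {n d : ℕ}

open Polynomial in
theorem ev_eq_eval (p : Poly F d) (x : F) :
    ev p x = (∑ k : Fin (d + 1), C (p k) * X ^ (k : ℕ) : F[X]).eval x := by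
  simp [ev, eval_finsetSum]

open Polynomial in
theorem degree_sum_lt (p : Poly F d) :
    (∑ k : Fin (d + 1), C (p k) * X ^ (k : ℕ) : F[X]).degree < (d + 1 : ℕ) := by
  refine (degree_sum_le _ _).trans_lt ((Finset.sup_lt_iff (WithBot.bot_lt_coe _)).2 fun k _ => ?_)
  exact (degree_C_mul_X_pow_le _ _).trans_lt (by exact_mod_cast k.2)

open Polynomial in
theorem coeff_sum (p : Poly F d) (k : Fin (d + 1)) :
    (∑ k : Fin (d + 1), C (p k) * X ^ (k : ℕ) : F[X]).coeff k = p k := by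
  simp [finsetSum_coeff, coeff_C_mul, coeff_X_pow, Fin.val_inj]

open Polynomial in
theorem ev_coeff {P : F[X]} (hP : P.degree < (d + 1 : ℕ)) (x : F) :
    ev (fun k : Fin (d + 1) => P.coeff k) x = P.eval x := by
  rw [ev, eval_eq_sum_range' (n := d + 1), Finset.sum_range]
  by_cases h : P = 0
  · simp [h]
  · exact (natDegree_lt_iff_degree_lt h).2 hP

theorem ev_zero (p : Poly F d) : ev p 0 = p 0 := by
  simp [ev, Fin.sum_univ_succ]

theorem ev_add (p q : Poly F d) (x : F) : ev (p + q) x = ev p x + ev q x := by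
  simp [ev, add_mul, Finset.sum_add_distrib]

theorem ev_smul (a : F) (p : Poly F d) (x : F) : ev (a • p) x = a * ev p x := by
  simp [ev, Finset.mul_sum, mul_assoc]

theorem eq_of_ev_eq {α : Fin n → F} (hα : Function.Injective α) {S : Finset (Fin n)}
    (hS : d < S.card) {p q : Poly F d} (h : ∀ i ∈ S, ev p (α i) = ev q (α i)) : p = q := by
  have := Polynomial.eq_of_degrees_lt_of_eval_index_eq S hα.injOn
    ((degree_sum_lt p).trans_le (by exact_mod_cast hS))
    ((degree_sum_lt q).trans_le (by exact_mod_cast hS))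
    (fun i hi => by rw [← ev_eq_eval, ← ev_eq_eval, h i hi])
  funext k
  rw [← coeff_sum p, this, coeff_sum]

theorem exists_ev_eq {ι : Type*} [DecidableEq ι] (S : Finset ι) {v : ι → F}
    (hv : Set.InjOn v S) (hS : S.card ≤ d + 1) (y : ι → F) :
    ∃ p : Poly F d, ∀ i ∈ S, ev p (v i) = y i := by
  refine ⟨fun k => (Lagrange.interpolate S v y).coeff k, fun i hi => ?_⟩
  rw [ev_coeff ((Lagrange.degree_interpolate_lt y hv).trans_le (by exact_mod_cast hS)),
    Lagrange.eval_interpolate_at_node y hv hi]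

/-- A degree-`d` polynomial with constant term `1` that vanishes at at most `d` given points. -/
theorem exists_vanishing {α : Fin n → F} (hα : Function.Injective α) (h0 : ∀ i, α i ≠ 0)
    (S : Finset (Fin n)) (hS : S.card ≤ d) :
    ∃ z : Poly F d, z 0 = 1 ∧ ∀ i ∈ S, ev z (α i) = 0 := by
  -- The index `none` stands for the extra node `0`, distinct from the others because the `α i` are
  -- non-zero; together there are at most `d + 1` nodes.
  obtain ⟨z, hz⟩ := exists_ev_eq (d := d) (Finset.insertNone S)
    (v := fun i : Option (Fin n) => i.elim 0 α) (by
      rintro (_ | i) - (_ | j) - h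
      · rfl
      · exact absurd h.symm (h0 j)
      · exact absurd h (h0 i)
      · exact congrArg some (hα h)) (by simpa using hS) (fun i => i.elim 1 fun _ => 0)
  refine ⟨z, ?_, fun i hi => ?_⟩
  · rw [← ev_zero z]; exact hz none (by simp)
  · exact hz (some i) (by simpa using hi)

theorem ev_row (R : Bivar F d) (x y : F) : ev (row R y) x = ev₂ R x y := by
  simp only [ev, row, ev₂, Finset.sum_mul]
  exact Finset.sum_congr rfl fun i _ => Finset.sum_congr rfl fun j _ => by ring

theorem ev_col (R : Bivar F d) (x y : F) : ev (col R x) y = ev₂ R x y := by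
  simp only [ev, col, ev₂, Finset.sum_mul]
  rw [Finset.sum_comm]

theorem row_apply (R : Bivar F d) (y : F) (i : Fin (d + 1)) : row R y i = ev (R i) y := rfl

theorem ev₂_zero_left (R : Bivar F d) (y : F) : ev₂ R 0 y = ev (R 0) y := by
  rw [← ev_row, ev_zero, row_apply]

/-- The product `a * z(x) * z(y)`, as a bivariate polynomial. -/
def mask (a : F) (z : Poly F d) : Bivar F d := fun i j => a * z i * z j

theorem row_add (R R' : Bivar F d) (y : F) : row (R + R') y = row R y + row R' y := by
  funext i; simp [row, add_mul, Finset.sum_add_distrib]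

theorem col_add (R R' : Bivar F d) (y : F) : col (R + R') y = col R y + col R' y := by
  funext i; simp [col, add_mul, Finset.sum_add_distrib]

theorem row_mask (a : F) {z : Poly F d} {y : F} (h : ev z y = 0) : row (mask a z) y = 0 := by
  funext i
  have : row (mask a z) y i = a * z i * ev z y := by
    simp [row, mask, ev, Finset.mul_sum, mul_assoc]
  simp [this, h]

theorem col_mask (a : F) {z : Poly F d} {y : F} (h : ev z y = 0) : col (mask a z) y = 0 := by
  funext i
  have : col (mask a z) y i = a * z i * ev z y := by
    simp only [col, mask, ev, Finset.mul_sum]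
    exact Finset.sum_congr rfl fun j _ => by ring
  simp [this, h]

/-- The coefficient of `x ^ k` in a row is the polynomial `R k` evaluated at the row's point, so
more than `d` rows determine each `R k`. -/
theorem bivar_ext {α : Fin n → F} (hα : Function.Injective α) {S : Finset (Fin n)}
    (hS : d < S.card) {R R' : Bivar F d} (h : ∀ i ∈ S, row R (α i) = row R' (α i)) : R = R' := by
  funext k
  exact eq_of_ev_eq hα hS fun i hi => congrFun (h i hi) k

/-- Pairwise consistent row- and column-polynomials lie on a bivariate polynomial. -/
theorem exists_bivar {α : Fin n → F} (hα : Function.Injective α) {S : Finset (Fin n)}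
    (hS : d < S.card) {f g : Fin n → Poly F d}
    (h : ∀ i ∈ S, ∀ j ∈ S, ev (f i) (α j) = ev (g j) (α i)) :
    ∃ R : Bivar F d, ∀ i ∈ S, f i = row R (α i) ∧ g i = col R (α i) := by
  obtain ⟨T, hTS, hT⟩ := Finset.exists_subset_card_eq (Nat.succ_le_of_lt hS)
  -- Interpolate in `y`, one coefficient of the rows at a time; `d + 1` rows suffice.
  choose R hR using fun k : Fin (d + 1) =>
    exists_ev_eq (d := d) T hα.injOn hT.le (fun i => f i k)
  have hrow : ∀ i ∈ T, f i = row R (α i) := fun i hi => funext fun k => (hR k i hi).symm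
  have hcol : ∀ i ∈ S, g i = col R (α i) := fun i hi =>
    eq_of_ev_eq hα (S := T) (by omega) fun j hj => by
      rw [← h j (hTS hj) i hi, hrow j hj, ev_row, ev_col]
  -- Rows outside `T` were not interpolated; they are recovered from their values on the columns of
  -- `T`.
  refine ⟨R, fun i hi => ⟨eq_of_ev_eq hα (S := T) (by omega) fun j hj => ?_, hcol i hi⟩⟩
  rw [h i hi j (hTS hj), hcol j (hTS hj), ev_row, ev_col]

end

/-! ### Decoding, uniform coins and Shamir's scheme -/

section

variable {F : Type u} [Field F] {n d : ℕ}

/-- The chosen polynomial and `p` each differ from the word in at most `r` places, so they agree at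
`n - 2 * r > d` points at least. -/
theorem rsDec_eq [DecidableEq F] {α : Fin n → F} (hα : Function.Injective α) {r : ℕ}
    (hn : d + 2 * r < n) {W : Fin n → F} {C : Finset (Fin n)} (hC : C.card ≤ r) {p : Poly F d}
    (h : ∀ i, i ∉ C → W i = ev p (α i)) : rsDec α d r W = p := by
  classical
  have hex : ∃ p : Poly F d, (Finset.univ.filter fun i => ev p (α i) ≠ W i).card ≤ r := by
    refine ⟨p, (Finset.card_le_card fun i hi => ?_).trans hC⟩
    by_contra hi'
    simp [h i hi'] at hi
  have heq : rsDec α d r W = hex.choose := by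
    unfold rsDec
    exact dif_pos hex
  rw [heq]
  set E := Finset.univ.filter fun i => ev hex.choose (α i) ≠ W i
  have hE : E.card ≤ r := hex.choose_spec
  refine eq_of_ev_eq hα (S := (E ∪ C)ᶜ) ?_ fun i hi => ?_
  · have := Finset.card_union_le E C
    rw [Finset.card_compl, Fintype.card_fin]
    omega
  · simp only [Finset.mem_compl, Finset.mem_union, not_or, E, Finset.mem_filter,
      Finset.mem_univ, true_and, not_not] at hi
    rw [hi.1, h i hi.2]

/-- A bijection only permutes terms of equal weight. Both secrecy proofs compare two secrets through
a translation of the coins in this way. -/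
theorem uniform_bind_equiv {X Y : Type*} [Fintype X] [Nonempty X] (e : X ≃ X) (f : X → PMF Y) :
    (PMF.uniformOfFintype X).bind (fun x => f (e x)) = (PMF.uniformOfFintype X).bind f := by
  ext y
  simp only [PMF.bind_apply, PMF.uniformOfFintype_apply]
  exact e.tsum_eq fun x => (Fintype.card X : ENNReal)⁻¹ * f x y

theorem uniform_map_equiv {X Y : Type*} [Fintype X] [Nonempty X] (e : X ≃ X) (f : X → Y) :
    (PMF.uniformOfFintype X).map (fun x => f (e x)) = (PMF.uniformOfFintype X).map f :=
  uniform_bind_equiv e fun x => PMF.pure (f x)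

variable [Fintype F]

theorem shamir_isThreshold {α : Fin n → F} (hα : Function.Injective α) (h0 : ∀ i, α i ≠ 0)
    (t : ℕ) : (shamir α t).IsThreshold t := by
  refine ⟨fun s q I hI => ?_, fun I hI s s' => ?_⟩
  · change Fin t → F at q
    set p : Poly F t := Fin.cons s q
    have hinj : Set.InjOn (fun i : {i // i ∈ I} => α i) (Finset.univ : Finset {i // i ∈ I}) :=
      fun i _ j _ h => Subtype.ext (hα h)
    have := Lagrange.eq_interpolate_of_eval_eq (s := (Finset.univ : Finset {i // i ∈ I}))
      (v := fun i => α i) (fun i => ev p (α i)) hinj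
      ((degree_sum_lt p).trans_le (by simp [hI])) (fun i _ => (ev_eq_eval p (α i)).symm)
    change (Lagrange.interpolate (Finset.univ : Finset {i // i ∈ I}) (fun i => α i)
      (fun i => ev p (α i))).eval 0 = s
    rw [← this, ← ev_eq_eval, ev_zero]
    rfl
  · obtain ⟨z, hz, hv⟩ := exists_vanishing hα h0 I hI.le
    -- The coins are the non-constant coefficients; the constant coefficient of `(s' - s) • z` is
    -- the change of the secret itself.
    set w : Fin t → F := fun k => (s' - s) * z k.succ
    let shares (a : F) (q : Fin t → F) (i : {i // i ∈ I}) : F := ev (d := t) (Fin.cons a q) (α i)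
    have key : shares s = fun q => shares s' (Equiv.addRight w q) := by
      funext q i
      have : (Fin.cons s' (q + w) : Poly F t) = (Fin.cons s q : Poly F t) + (s' - s) • z := by
        funext k
        refine Fin.cases ?_ (fun k => ?_) k <;> simp [hz, w]
      change _ = ev (d := t) (Fin.cons s' (q + w)) (α i)
      rw [this, ev_add, ev_smul, hv i i.2, mul_zero, add_zero]
    change (PMF.uniformOfFintype (Fin t → F)).map (shares s) =
      (PMF.uniformOfFintype (Fin t → F)).map (shares s')
    rw [key, uniform_map_equiv]

theorem isSharing_iff {α : Fin n → F} {t : ℕ} {C : Finset (Fin n)} {s : F} {sh : Fin n → F} :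
    (shamir α t).IsSharing C s sh ↔
      ∃ p : Poly F t, p 0 = s ∧ ∀ i, i ∉ C → sh i = ev p (α i) := by
  constructor
  · rintro ⟨q, h⟩
    change Fin t → F at q
    exact ⟨(Fin.cons s q : Fin (t + 1) → F), rfl, h⟩
  · rintro ⟨p, rfl, h⟩
    refine ⟨(Fin.tail p : Fin t → F), fun i hi => ?_⟩
    change _ = ev (d := t) (Fin.cons (p 0) (Fin.tail p)) (α i)
    rw [Fin.cons_self_tail, h i hi]

end

end BGW

/-! ### Consistency of honest views, for an arbitrary dealer -/

namespace BGW

section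

variable {F : Type u} [Field F] [DecidableEq F] {n t : ℕ} (α : Fin n → F) (D : Fin n)
  (C : Finset (Fin n))

/-- The messages of a round depend only on the input, the coins and the earlier rounds. -/
theorem shSend_congr {v w : ShView F n t} (hin : v.input = w.input) (hco : v.coins = w.coins)
    (r : Fin 7) (h : ∀ r' < r, v.recv r' = w.recv r') (i : Fin n) :
    shSend α D r i v = shSend α D r i w := by
  have hp : dealerPoly v = dealerPoly w := by simp only [dealerPoly, hin, hco]
  -- Rounds are indexed from `0`; each quantity below is available once the last round it reads lies
  -- before `r`.
  have hrec : 0 < r → received D v = received D w := fun hr => by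
    simp only [received, h 0 hr]
  have hcl : 1 < r → complaintList α D v = complaintList α D w := fun hr => by
    have hcv : crossValue v = crossValue w := by funext j; simp only [crossValue, h 1 hr]
    ext j
    rw [complaintList, complaintList, Finset.mem_filter, Finset.mem_filter, hcv,
      hrec (Nat.zero_lt_one.trans hr)]
  have hcm : 2 < r → complaints v = complaints w := fun hr => by
    funext k; simp only [complaints, h 2 hr]
  have hres : 3 < r → resolved D v = resolved D w := fun hr => by
    funext k j; simp only [resolved, h 3 hr]
  have hac : 4 < r → accusers₁ v = accusers₁ w := fun hr => by
    simp only [accusers₁, h 4 hr]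
  have hpub : 5 < r → published D v = published D w := fun hr => by
    funext k; simp only [published, h 5 hr]
  fin_cases r
  · simp only [shSend, hp]
  · simp only [shSend, hrec (by decide)]
  · simp only [shSend, hcl (by decide)]
  · simp only [shSend, hp, hcm (by decide)]
  · have : Accuses₁ α D i v = Accuses₁ α D i w := by
      simp only [Accuses₁, hrec (by decide), hcl (by decide), hcm (by decide), hres (by decide)]
    change shSend α D 4 i v = shSend α D 4 i w
    unfold shSend
    simp only
    rw [this]
  · simp only [shSend, hp, hac (by decide)]
  · have : Accuses₂ α D i v = Accuses₂ α D i w := by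
      simp only [Accuses₂, hrec (by decide), hpub (by decide)]
    change shSend α D 6 i v = shSend α D 6 i w
    unfold shSend
    simp only
    rw [this]

/-- The relations between the final views of the parties in an execution of the sharing protocol
with corrupt parties `C`. -/
structure IsExecution (views : Fin n → ShView F n t) : Prop where
  cross : ∀ i j, j ∉ C → crossValue (views i) j = ev (received D (views j)).1 (α i)
  list : ∀ i k, k ∉ C → complaints (views i) k = complaintList α D (views k)
  accuses₁ : ∀ i k, k ∉ C → (k ∈ accusers₁ (views i) ↔ Accuses₁ α D k (views k))
  accuses : ∀ i k, k ∉ C →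
    (k ∈ accusers (views i) ↔ Accuses₁ α D k (views k) ∨ Accuses₂ α D k (views k))
  complaints_eq : ∀ i j, complaints (views i) = complaints (views j)
  resolved_eq : ∀ i j, resolved D (views i) = resolved D (views j)
  accusers₁_eq : ∀ i j, accusers₁ (views i) = accusers₁ (views j)
  published_eq : ∀ i j, published D (views i) = published D (views j)
  accusers_eq : ∀ i j, accusers (views i) = accusers (views j)

/-- The behaviour of an honest dealer with bivariate polynomial `R`. -/
structure HonestDealer (R : Bivar F t) (views : Fin n → ShView F n t) : Prop where
  received : ∀ i, received D (views i) = (row R (α i), col R (α i))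
  resolved : ∀ i k j, resolved D (views i) k j =
    if j ∈ complaints (views i) k then some (ev₂ R (α k) (α j)) else none
  published : ∀ i k, published D (views i) k =
    if k ∈ accusers₁ (views i) then some (row R (α k), col R (α k)) else none

variable {α D C}
variable {views : Fin n → ShView F n t}

namespace IsExecution

theorem accusers₁_subset (v : ShView F n t) : accusers₁ v ⊆ accusers v :=
  Finset.subset_union_left

/-- The decision uses broadcasts only, and these look the same to everyone. -/
theorem discarded_iff (hE : IsExecution α D C views) (i j : Fin n) :
    Discarded D (views i) ↔ Discarded D (views j) := by
  unfold Discarded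
  rw [hE.complaints_eq i j, hE.resolved_eq i j, hE.accusers₁_eq i j, hE.published_eq i j,
    hE.accusers_eq i j]

theorem mem_complaintList (hE : IsExecution α D C views) {i j : Fin n} (hj : j ∉ C) :
    j ∈ complaintList α D (views i) ↔
      ev (received D (views j)).1 (α i) ≠ ev (received D (views i)).2 (α j) := by
  simp [complaintList, hE.cross i j hj]

/-- Honest parties that did not accuse a dealer who answered all complaints hold consistent
polynomials. -/
theorem consistent (hE : IsExecution α D C views) {i j : Fin n} (hi : i ∉ C) (hj : j ∉ C)
    (hi' : i ∉ accusers₁ (views i)) (hj' : j ∉ accusers₁ (views i)) :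
    ev (received D (views i)).1 (α j) = ev (received D (views j)).2 (α i) := by
  by_contra hne
  have hmem : i ∈ complaintList α D (views j) := (hE.mem_complaintList hi).2 hne
  rw [hE.accuses₁ _ _ hi] at hi'
  rw [hE.accuses₁ _ _ hj] at hj'
  simp only [Accuses₁, not_or, not_exists, not_and, not_not] at hi' hj'
  -- The dealer's public answer to the complaint of `j` about `i` must equal the row value of `i`,
  -- as `i` stayed silent, and the column value of `j`, as `j` did.
  have h1 := hi'.2.1 j (by rw [hE.list i j hj]; exact hmem)
  have h2 := hj'.2.2 i hmem
  rw [hE.resolved_eq i j, h2] at h1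
  exact hne (Option.some.inj h1).symm

/-- If the dealer is not discarded, the polynomials of the honest parties lie on exactly one
bivariate polynomial. -/
theorem exists_bivar (hE : IsExecution α D C views) (hα : Function.Injective α)
    (hn : 3 * t < n) (hC : C.card ≤ t) (i₀ : Fin n) (hdis : ¬ Discarded D (views i₀)) :
    t + 1 ≤ (Finset.univ.filter fun i => i ∉ C ∧ i ∉ accusers (views i₀)).card ∧
    ∃ R : Bivar F t,
      (∀ R' : Bivar F t,
        (∀ i ∈ Finset.univ.filter fun i => i ∉ C ∧ i ∉ accusers (views i₀),
          received D (views i) = (row R' (α i), col R' (α i))) ↔ R' = R) ∧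
      ∀ i, i ∉ C → finalPolys D i (views i) = (row R (α i), col R (α i)) := by
  set H : Finset (Fin n) := Finset.univ.filter fun i => i ∉ C ∧ i ∉ accusers (views i₀) with hHdef
  have hH : ∀ {i}, i ∈ H ↔ i ∉ C ∧ i ∉ accusers (views i₀) := by simp [hHdef]
  have hdis' := hdis
  simp only [Discarded, not_or, not_exists, not_and, not_lt] at hdis'
  obtain ⟨-, hpub, hacc⟩ := hdis'
  have hcard : t + 1 ≤ H.card := by
    have h1 : H = (C ∪ accusers (views i₀))ᶜ := by
      ext i; simp [hH]
    have := Finset.card_union_le C (accusers (views i₀))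
    rw [h1, Finset.card_compl, Fintype.card_fin]
    omega
  have hcons : ∀ i j, i ∉ C → j ∉ C → i ∉ accusers₁ (views i₀) → j ∉ accusers₁ (views i₀) →
      ev (received D (views i)).1 (α j) = ev (received D (views j)).2 (α i) := by
    intro i j hi hj hi' hj'
    rw [hE.accusers₁_eq i₀ i] at hi' hj'
    exact hE.consistent hi hj hi' hj'
  have hH₁ : ∀ {i}, i ∈ H → i ∉ accusers₁ (views i₀) := fun h h' =>
    (hH.1 h).2 (accusers₁_subset _ h')
  obtain ⟨R, hR⟩ := BGW.exists_bivar hα (S := H) (by omega)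
    (f := fun i => (received D (views i)).1) (g := fun i => (received D (views i)).2)
    fun i hi j hj => hcons i j (hH.1 hi).1 (hH.1 hj).1 (hH₁ hi) (hH₁ hj)
  refine ⟨hcard, R, fun R' => ⟨fun h => ?_, ?_⟩, fun i hi => ?_⟩
  · exact bivar_ext hα (S := H) (by omega) fun i hi => by
      rw [← (hR i hi).1, h i hi]
  · rintro rfl i hi
    exact Prod.ext (hR i hi).1 (hR i hi).2
  -- Consistency with the `t + 1` parties of `H` alone forces a pair onto `R`.
  · have key : ∀ p : Poly F t × Poly F t,
        (∀ j ∈ H, ev p.1 (α j) = ev (received D (views j)).2 (α i) ∧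
          ev p.2 (α j) = ev (received D (views j)).1 (α i)) →
        p = (row R (α i), col R (α i)) := by
      intro p hp
      refine Prod.ext (eq_of_ev_eq hα (S := H) (by omega) fun j hj => ?_)
        (eq_of_ev_eq hα (S := H) (by omega) fun j hj => ?_)
      · rw [(hp j hj).1, (hR j hj).2, ev_col, ev_row]
      · rw [(hp j hj).2, (hR j hj).1, ev_row, ev_col]
    apply key
    intro j hj
    obtain ⟨hjC, hja⟩ := hH.1 hj
    -- A published pair was checked in the last round by every silent party of `H`. Without one, `i`
    -- cannot have accused in the fifth round, as an unanswered accusation discards the dealer; so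
    -- its original pair is consistent with `H`, even if it accused in the last round.
    cases hpi : published D (views i) i with
    | some p =>
      rw [hE.accuses _ _ hjC, not_or] at hja
      have h2 := hja.2
      simp only [Accuses₂, not_exists, not_and, not_or, not_not] at h2
      simpa [finalPolys, hpi] using h2 i p (by rw [hE.published_eq j i, hpi])
    | none =>
      have hi' : i ∉ accusers₁ (views i₀) := fun h =>
        hpub i h (by rw [hE.published_eq i₀ i, hpi])
      simpa [finalPolys, hpi] using
        ⟨hcons i j hi hjC hi' (hH₁ hj), (hcons j i hjC hi (hH₁ hj) hi').symm⟩

/-- The shares of the honest parties lie on a degree-`t` polynomial. -/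
theorem exists_shares (hE : IsExecution α D C views) (hα : Function.Injective α)
    (hn : 3 * t < n) (hC : C.card ≤ t) :
    ∃ p : Poly F t, ∀ i, i ∉ C → share D i (views i) = ev p (α i) := by
  by_cases hdis : Discarded D (views D)
  · refine ⟨0, fun i _ => ?_⟩
    rw [share, if_pos ((hE.discarded_iff i D).2 hdis)]
    simp [ev]
  · obtain ⟨-, R, -, hR⟩ := hE.exists_bivar hα hn hC D hdis
    -- `R 0` holds the coefficients of `R(0, y)`, the polynomial that carries the shares.
    refine ⟨R 0, fun i hi => ?_⟩
    rw [share, if_neg (fun h => hdis ((hE.discarded_iff i D).1 h)), hR i hi, ev_row,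
      ev₂_zero_left]

/-! ### Behaviour of honest parties under an honest dealer -/

section HonestDealer

variable {R : Bivar F t}

theorem notMem_complaintList (hE : IsExecution α D C views) (hD : HonestDealer α D R views)
    {i j : Fin n} (hj : j ∉ C) : j ∉ complaintList α D (views i) := by
  rw [hE.mem_complaintList hj, hD.received, hD.received]
  simp [ev_row, ev_col]

/-- Only corrupt parties can appear on an honest complaint-list, so it has at most `t` entries and
omits its owner; all public answers are true values of `R`. -/
theorem not_accuses₁ (hE : IsExecution α D C views) (hD : HonestDealer α D R views)
    (hC : C.card ≤ t) {i : Fin n} (hi : i ∉ C) : ¬ Accuses₁ α D i (views i) := by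
  have hsub : complaintList α D (views i) ⊆ C := fun j hj => by
    by_contra h
    exact hE.notMem_complaintList hD h hj
  rintro ((h | h) | ⟨k, hk, h⟩ | ⟨j, hj, h⟩)
  · exact absurd ((Finset.card_le_card hsub).trans hC) (not_le.2 h)
  · exact hE.notMem_complaintList hD hi h
  · rw [hD.resolved, if_pos hk, hD.received, ev_row] at h
    exact h rfl
  · rw [hD.resolved, hE.list i i hi, if_pos hj, hD.received, ev_col] at h
    exact h rfl

theorem not_accuses₂ (hD : HonestDealer α D R views) (i : Fin n) :
    ¬ Accuses₂ α D i (views i) := by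
  rintro ⟨j, p, hp, h⟩
  rw [hD.published] at hp
  split_ifs at hp
  obtain rfl := Option.some.inj hp
  simp [hD.received, ev_row, ev_col] at h

theorem accusers_subset (hE : IsExecution α D C views) (hD : HonestDealer α D R views)
    (hC : C.card ≤ t) (i : Fin n) : accusers (views i) ⊆ C := by
  intro k hk
  by_contra h
  rw [hE.accuses i k h] at hk
  exact hk.elim (hE.not_accuses₁ hD hC h) (not_accuses₂ hD k)

/-- An honest dealer is not discarded, and the share of every honest party is the correct one. -/
theorem share_eq (hE : IsExecution α D C views) (hD : HonestDealer α D R views)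
    (hC : C.card ≤ t) {i : Fin n} (hi : i ∉ C) : share D i (views i) = ev (R 0) (α i) := by
  have hdis : ¬ Discarded D (views i) := by
    rintro (⟨k, j, hj, h⟩ | ⟨k, hk, h⟩ | h)
    · simp [hD.resolved, hj] at h
    · simp [hD.published, hk] at h
    · exact absurd ((Finset.card_le_card (hE.accusers_subset hD hC i)).trans hC) (not_le.2 h)
  -- An honest dealer publishes polynomials of first-stage accusers only, and these are corrupt.
  have hpub : published D (views i) i = none := by
    rw [hD.published, if_neg fun h => hi (hE.accusers_subset hD hC i (accusers₁_subset _ h))]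
  rw [share, if_neg hdis, finalPolys, hpub, Option.getD_none, hD.received, ev_row,
    ev₂_zero_left]

end HonestDealer

end IsExecution

end

/-! ### Executions of the sharing protocol satisfy these relations -/

section

variable {F : Type u} [Field F] [Fintype F] [DecidableEq F] {n t : ℕ} (α : Fin n → F) (D : Fin n)
  (C : Finset (Fin n))

/-- The sender used a truncated view, but `shSend` never reads the current or later rounds, so the
final view gives the same message. -/
theorem sharing_exec_of_notMem (A : (sharing α t D).Strategy C) (x : Fin n → Option F)
    (c : Fin n → ShCoins F t) (r : Fin 7) {i : Fin n} (hi : i ∉ C) :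
    (sharing α t D).exec C A x c r i =
      shSend α D r i ((sharing α t D).finalView C A x c i) := by
  refine ((sharing α t D).exec_of_notMem C A x c r hi).trans ?_
  change shSend α D r i ((sharing α t D).view x c
      ((sharing α t D).before ((sharing α t D).exec C A x c) r) i) =
    shSend α D r i ((sharing α t D).view x c ((sharing α t D).exec C A x c) i)
  refine shSend_congr α D ?_ ?_ r (fun r' hr' => ?_) i
  · rfl
  · rfl
  have : ∀ j, (sharing α t D).before ((sharing α t D).exec C A x c) r r' j =
      (sharing α t D).exec C A x c r' j := fun j => if_pos hr'
  simp only [SyncNet.Protocol.view, this]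

theorem isExecution (A : (sharing α t D).Strategy C) (x : Fin n → Option F)
    (c : Fin n → ShCoins F t) :
    IsExecution α D C ((sharing α t D).finalView C A x c) := by
  have hs := fun r i hi => sharing_exec_of_notMem α D C A x c r (i := i) hi
  set views : Fin n → ShView F n t := (sharing α t D).finalView C A x c
  have hp : ∀ r i j, ((views i).recv r).priv j = ((sharing α t D).exec C A x c r j).priv i :=
    fun _ _ _ => rfl
  have hb : ∀ r i j, ((views i).recv r).bc j = ((sharing α t D).exec C A x c r j).bc :=
    fun _ _ _ => rfl
  have h₁ : ∀ i k, k ∉ C → (k ∈ accusers₁ (views i) ↔ Accuses₁ α D k (views k)) := by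
    intro i k hk
    simp only [accusers₁, Finset.mem_filter, Finset.mem_univ, true_and]
    rw [hb, hs 4 k hk]
    by_cases h : Accuses₁ α D k (views k) <;> simp [shSend, h]
  refine ⟨fun i j hj => ?_, fun i k hk => ?_, h₁, fun i k hk => ?_, fun i j => rfl,
    fun i j => rfl, fun i j => rfl, fun i j => rfl, fun i j => rfl⟩
  · rw [crossValue, hp, hs 1 j hj]
    rfl
  · rw [complaints, hb, hs 2 k hk]
    rfl
  · simp only [accusers, Finset.mem_union, h₁ i k hk, Finset.mem_filter, Finset.mem_univ, true_and]
    rw [hb, hs 6 k hk]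
    by_cases h : Accuses₂ α D k (views k) <;> simp [shSend, h]

theorem honestDealer (A : (sharing α t D).Strategy C) (x : Fin n → Option F)
    (c : Fin n → ShCoins F t) (hD : D ∉ C) :
    HonestDealer α D (dealerPoly ((sharing α t D).finalView C A x c D))
      ((sharing α t D).finalView C A x c) := by
  have hs := fun r => sharing_exec_of_notMem α D C A x c r hD
  set views : Fin n → ShView F n t := (sharing α t D).finalView C A x c
  have hp : ∀ r i j, ((views i).recv r).priv j = ((sharing α t D).exec C A x c r j).priv i :=
    fun _ _ _ => rfl
  have hb : ∀ r i j, ((views i).recv r).bc j = ((sharing α t D).exec C A x c r j).bc :=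
    fun _ _ _ => rfl
  refine ⟨fun i => ?_, fun i k j => ?_, fun i k => ?_⟩
  · rw [received, hp, hs 0]
    simp [shSend]
  · rw [resolved, hb, hs 3]
    simp [shSend]
    rfl
  · rw [published, hb, hs 5]
    simp [shSend]
    rfl

end

end BGW

/-! ### Privacy -/

namespace BGW

section

variable {F : Type u} [Field F] [Fintype F] [DecidableEq F] {n t : ℕ} {α : Fin n → F} {D : Fin n}
  {C : Finset (Fin n)}

/-- The bivariate polynomial of a dealer with secret `s` and coins `k`. -/
def coinPoly (s : F) (k : ShCoins F t) : Bivar F t := Fin.cons (Fin.cons s k.1) k.2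

/-- The change of the dealer's coins that adds the mask `mask a z`. -/
def coinShift (a : F) (z : Poly F t) : ShCoins F t :=
  (fun k => mask a z 0 k.succ, fun i => mask a z i.succ)

/-- The coins hold every coefficient except the one at `(0, 0)`, where the mask contributes exactly
`s' - s`. -/
theorem coinPoly_add (s s' : F) (k : ShCoins F t) {z : Poly F t} (hz : z 0 = 1) :
    coinPoly s' (k + coinShift (s' - s) z) = coinPoly s k + mask (s' - s) z := by
  funext i j
  refine Fin.cases ?_ (fun i => ?_) i
  · refine Fin.cases ?_ (fun j => ?_) j
    · simp [coinPoly, mask, hz]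
    · simp [coinPoly, coinShift]
  · simp [coinPoly, coinShift]

theorem dealerPoly_finalView (A : (sharing α t D).Strategy C) (s : F) (c : Fin n → ShCoins F t) :
    dealerPoly ((sharing α t D).finalView C A (VSSScheme.inputs D s) c D) = coinPoly s (c D) := by
  simp [dealerPoly, coinPoly, SyncNet.Protocol.finalView, SyncNet.Protocol.view,
    VSSScheme.inputs]

/-- If an honest dealer adds to its polynomial a bivariate polynomial that vanishes on the rows and
columns of the corrupt parties, the broadcasts of the honest parties and their messages to corrupt
parties in round `r` do not change, provided that this was so for all messages before round `r`
apart from those between honest parties. -/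
theorem shSend_agree (hC : C.card ≤ t) {views views' : Fin n → ShView F n t}
    (hE : IsExecution α D C views) (hE' : IsExecution α D C views') {R M : Bivar F t}
    (hR : HonestDealer α D R views) (hR' : HonestDealer α D (R + M) views')
    (hp : dealerPoly (views D) = R) (hp' : dealerPoly (views' D) = R + M)
    (hrow : ∀ i ∈ C, row M (α i) = 0) (hcol : ∀ i ∈ C, col M (α i) = 0) (r : Fin 7)
    (hbc : ∀ r' < r, ∀ i k, ((views i).recv r').bc k = ((views' i).recv r').bc k)
    (hpriv : ∀ r' < r, ∀ i, ∀ k ∈ C, ((views i).recv r').priv k = ((views' i).recv r').priv k)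
    {i : Fin n} (hi : i ∉ C) :
    (shSend α D r i (views i)).bc = (shSend α D r i (views' i)).bc ∧
      ∀ j ∈ C, (shSend α D r i (views i)).priv j = (shSend α D r i (views' i)).priv j := by
  have hrow' : ∀ i ∈ C, row (R + M) (α i) = row R (α i) := fun i hi => by
    rw [row_add, hrow i hi, add_zero]
  have hcol' : ∀ i ∈ C, col (R + M) (α i) = col R (α i) := fun i hi => by
    rw [col_add, hcol i hi, add_zero]
  have hval : ∀ i j, i ∈ C ∨ j ∈ C → ev₂ (R + M) (α i) (α j) = ev₂ R (α i) (α j) := by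
    rintro i j (h | h)
    · rw [← ev_col, hcol' i h, ev_col]
    · rw [← ev_row, hrow' j h, ev_row]
  have hcm : 2 < r → complaints (views i) = complaints (views' i) := fun h => by
    funext k
    rw [complaints, complaints, hbc 2 h i k]
  have hac : 4 < r → accusers₁ (views i) = accusers₁ (views' i) := fun h => by
    simp only [accusers₁, hbc 4 h i]
  match r with
  | 0 =>
    refine ⟨rfl, fun j hj => ?_⟩
    by_cases h : i = D
    · subst h
      simp [shSend, hp, hp', hrow' j hj, hcol' j hj]
    · simp [shSend, h]
  | 1 =>
    refine ⟨rfl, fun j hj => ?_⟩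
    simp [shSend, hR.received, hR'.received, ev_row, hval j i (Or.inl hj)]
  | 2 =>
    -- Honest parties are on neither list. For corrupt `j`, the value sent agrees by `hpriv` and the
    -- column value lies on an unchanged row.
    have : complaintList α D (views i) = complaintList α D (views' i) := by
      ext j
      by_cases hj : j ∈ C
      · have h : crossValue (views i) j = crossValue (views' i) j := by
          rw [crossValue, crossValue, hpriv 1 (by decide) i j hj]
        simp [complaintList, h, hR.received, hR'.received, ev_col, hval i j (Or.inr hj)]
      · simp only [hE.notMem_complaintList hR hj, hE'.notMem_complaintList hR' hj]
    exact ⟨by simp only [shSend, this], fun _ _ => rfl⟩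
  | 3 =>
    refine ⟨?_, fun _ _ => rfl⟩
    by_cases h : i = D
    · subst h
      simp only [shSend, hp, hp', ← hcm (by decide), if_pos]
      refine congrArg some (funext fun k => funext fun j => ?_)
      by_cases hj : j ∈ complaints (views i) k
      -- Honest parties never complain about each other, so a disputed point has a corrupt
      -- coordinate, where the mask vanishes.
      · have : k ∈ C ∨ j ∈ C := by
          by_contra! hkj
          rw [hE.list i k hkj.1] at hj
          exact hE.notMem_complaintList hR hkj.2 hj
        simp [hj, hval k j this]
      · simp [hj]
    · simp [shSend, h]
  | 4 =>
    simp [shSend, hE.not_accuses₁ hR hC hi, hE'.not_accuses₁ hR' hC hi]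
  | 5 =>
    refine ⟨?_, fun _ _ => rfl⟩
    by_cases h : i = D
    · subst h
      simp only [shSend, hp, hp', ← hac (by decide), if_pos]
      refine congrArg some (funext fun k => ?_)
      by_cases hk : k ∈ accusers₁ (views i)
      · have hkC : k ∈ C := hE.accusers_subset hR hC i (IsExecution.accusers₁_subset _ hk)
        simp [hk, hrow' k hkC, hcol' k hkC]
      · simp [hk]
    · simp [shSend, h]
  | 6 =>
    simp [shSend, IsExecution.not_accuses₂ hR i, IsExecution.not_accuses₂ hR' i]

/-- Adding a bivariate polynomial that vanishes on the rows and columns of the corrupt parties does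
not change their views. -/
theorem corrupt_view_eq (hC : C.card ≤ t) (hD : D ∉ C) (A : (sharing α t D).Strategy C) {s s' : F}
    {c c' : Fin n → ShCoins F t} (hc : ∀ i ∈ C, c i = c' i) {M : Bivar F t}
    (hM : coinPoly s' (c' D) = coinPoly s (c D) + M)
    (hrow : ∀ i ∈ C, row M (α i) = 0) (hcol : ∀ i ∈ C, col M (α i) = 0) {i : Fin n} (hi : i ∈ C) :
    (sharing α t D).finalView C A (VSSScheme.inputs D s) c i =
      (sharing α t D).finalView C A (VSSScheme.inputs D s') c' i := by
  have hp := dealerPoly_finalView (α := α) A s c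
  have hp' := (dealerPoly_finalView (α := α) A s' c').trans hM
  have hR := honestDealer α D C A (VSSScheme.inputs D s) c hD
  have hR' := honestDealer α D C A (VSSScheme.inputs D s') c' hD
  rw [hp] at hR
  rw [hp'] at hR'
  have hin : ∀ i ∈ C, VSSScheme.inputs D s i = VSSScheme.inputs D s' i := fun i hi => by
    have : i ≠ D := fun e => hD (e ▸ hi)
    simp [VSSScheme.inputs, this]
  refine (sharing α t D).finalView_agree C A hin hc (fun r hbc hpriv i hi => ?_) hi
  rw [sharing_exec_of_notMem α D C A (VSSScheme.inputs D s) c r hi,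
    sharing_exec_of_notMem α D C A (VSSScheme.inputs D s') c' r hi]
  exact shSend_agree hC (isExecution α D C A (VSSScheme.inputs D s) c)
    (isExecution α D C A (VSSScheme.inputs D s') c') hR hR' hp hp' hrow hcol r hbc hpriv hi

/-- For a fixed tape, translating the dealer's coins matches each execution on `s` with one on `s'`
that the adversary cannot tell apart. -/
theorem scheme_privacy (hα : Function.Injective α) (h0 : ∀ i, α i ≠ 0) :
    (scheme α t D).Privacy D t := by
  intro C hC hD Tape tape A s s'
  obtain ⟨z, hz, hv⟩ := exists_vanishing hα h0 C hC
  let e : (Fin n → ShCoins F t) ≃ (Fin n → ShCoins F t) :=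
    Equiv.addRight (Pi.single D (coinShift (s' - s) z))
  have he : ∀ c, e c = c + Pi.single D (coinShift (s' - s) z) := fun _ => rfl
  let f (s : F) (c : Fin n → ShCoins F t) :
      PMF (Tape × ({i // i ∈ C} → (sharing α t D).PartyView)) :=
    tape.map fun w => (w, fun i => (sharing α t D).finalView C (A w) (VSSScheme.inputs D s) c i)
  have key : f s = fun c => f s' (e c) := by
    funext c
    simp only [f]
    congr 1
    funext w
    congr 1
    funext i
    refine corrupt_view_eq hC hD (A w) (M := mask (s' - s) z) (fun j hj => ?_) ?_
      (fun j hj => row_mask _ (hv j hj)) (fun j hj => col_mask _ (hv j hj)) i.2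
    · have : j ≠ D := fun h => hD (h ▸ hj)
      simp [he, this]
    · rw [he, Pi.add_apply, Pi.single_eq_same, coinPoly_add s s' _ hz]
  change (PMF.uniformOfFintype (Fin n → ShCoins F t)).bind (f s) =
    (PMF.uniformOfFintype (Fin n → ShCoins F t)).bind (f s')
  rw [key, uniform_bind_equiv]

end

end BGW

/-! ### Reconstruction, correctness and commitment -/

namespace BGW

section

variable {F : Type u} [Field F] [Fintype F] [DecidableEq F] {n t : ℕ} {α : Fin n → F} {D : Fin n}
  {C : Finset (Fin n)}

theorem reconstruction_exec_of_notMem (A : (reconstruction α t D).Strategy C)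
    (views : Fin n → ShView F n t) (c : Fin n → PUnit) {i : Fin n} (hi : i ∉ C) :
    (reconstruction α t D).exec C A views c (0 : Fin 1) i =
      { priv := fun _ => some (share D i (views i)), bc := none } :=
  (reconstruction α t D).exec_of_notMem C A views c (0 : Fin 1) hi

/-- Only the corrupt parties' values can be wrong; decoding degree `t` with `t` errors needs `t + 2
* t < n`. -/
theorem reconstruction_result (hα : Function.Injective α) (hn : 3 * t < n) (hC : C.card ≤ t)
    (A : (reconstruction α t D).Strategy C) (views : Fin n → ShView F n t) (c : Fin n → PUnit)
    {p : Poly F t} (hp : ∀ i, i ∉ C → share D i (views i) = ev p (α i)) (i : Fin n) :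
    (reconstruction α t D).result C A views c i = p 0 := by
  rw [← ev_zero p]
  refine congrArg (fun p : Poly F t => ev p 0) (rsDec_eq hα (by omega) hC fun j hj => ?_)
  change (((reconstruction α t D).exec C A views c (0 : Fin 1) j).priv i).getD 0 = _
  rw [reconstruction_exec_of_notMem A views c hj]
  exact hp j hj

theorem scheme_correctness (hα : Function.Injective α) (hn : 3 * t < n) :
    (scheme α t D).Correctness D t (shamir α t) := by
  intro C hC hD s c A
  have hE := isExecution α D C A (VSSScheme.inputs D s) c
  have hR := honestDealer α D C A (VSSScheme.inputs D s) c hD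
  rw [dealerPoly_finalView] at hR
  have hsh := fun i hi => hE.share_eq hR hC (i := i) hi
  exact ⟨isSharing_iff.2 ⟨_, rfl, hsh⟩,
    fun c' A' i _ => reconstruction_result hα hn hC A' _ c' hsh i⟩

theorem scheme_strongCommitment (hα : Function.Injective α) (hn : 3 * t < n) :
    (scheme α t D).StrongCommitment D t (shamir α t) := by
  classical
  intro C hC
  let P (v : {i // i ∉ C} → ShView F n t) (p : Poly F t) : Prop :=
    ∀ i : {i // i ∉ C}, share D i (v i) = ev p (α i)
  -- The committed value must be a function of the honest views alone, so it is read off any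
  -- polynomial through the honest shares; in an execution one always exists.
  refine ⟨fun v => if h : ∃ p, P v p then h.choose 0 else 0, fun s c A => ?_⟩
  intro views sStar
  have hE := isExecution α D C A (VSSScheme.inputs D s) c
  have hex : ∃ p, P (fun i => views i) p := by
    obtain ⟨p, hp⟩ := hE.exists_shares hα hn hC
    exact ⟨p, fun i => hp i i.2⟩
  have hs : sStar = hex.choose 0 := dif_pos hex
  have hsh : ∀ i, i ∉ C → share D i (views i) = ev hex.choose (α i) :=
    fun i hi => hex.choose_spec ⟨i, hi⟩
  rw [hs]
  exact ⟨isSharing_iff.2 ⟨_, rfl, hsh⟩,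
    fun c' A' i _ => reconstruction_result hα hn hC A' _ c' hsh i⟩

theorem scheme_commitsToBivariate (hα : Function.Injective α) (hn : 3 * t < n) :
    CommitsToBivariate α t D := by
  intro C hC s c A views i₀ _ hdis H
  have hE : IsExecution α D C views := isExecution α D C A (VSSScheme.inputs D s) c
  obtain ⟨hcard, R, hR, hfin⟩ := hE.exists_bivar hα hn hC i₀ hdis
  have hdis' : ∀ i, ¬ Discarded D (views i) := fun i h => hdis ((hE.discarded_iff i i₀).1 h)
  have hsh : ∀ i, i ∉ C → share D i (views i) = ev₂ R 0 (α i) := fun i hi => by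
    rw [share, if_neg (hdis' i), hfin i hi, ev_row]
  refine ⟨hcard, R, hR, fun i hi => ⟨hdis' i, hfin i hi, hsh i hi⟩, fun c' A' i _ => ?_⟩
  rw [ev₂_zero_left, ev_zero]
  exact reconstruction_result hα hn hC A' views c'
    (fun j hj => by rw [hsh j hj, ev₂_zero_left]) i

end

end BGW

/-! ### Communication -/

namespace BGW

open SyncNet.Protocol

section

/-- The spare code word costs at most one further bit. -/
theorem msgBits_le {M : Type u} {m : ℕ} (h : Nat.card M ≤ 2 ^ m) : msgBits M ≤ m + 1 := by
  refine Nat.clog_le_of_le_pow ?_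
  have := Nat.one_le_two_pow (n := m)
  rw [pow_succ]
  omega

theorem sum_ite_le_card_mul {n : ℕ} (S : Finset (Fin n)) (p : Fin n → Prop) [DecidablePred p]
    (m : ℕ) : ∑ i ∈ S, (if p i then m else 0) ≤ n * m := by
  calc ∑ i ∈ S, (if p i then m else 0) ≤ ∑ _i : Fin n, m :=
        (Finset.sum_le_sum fun i _ => by split_ifs <;> simp).trans
          (Finset.sum_le_sum_of_subset S.subset_univ)
    _ = n * m := by simp

/-- Serves the rounds in which only the dealer speaks, where a factor `n` must be saved. -/
theorem sum_le_of_eq_zero {n : ℕ} (S : Finset (Fin n)) {f : Fin n → ℕ} (D : Fin n) {m : ℕ}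
    (h : ∀ i ∈ S, i ≠ D → f i = 0) (hm : D ∈ S → f D ≤ m) : ∑ i ∈ S, f i ≤ m := by
  by_cases hD : D ∈ S
  · rw [Finset.sum_eq_single_of_mem D hD h]
    exact hm hD
  · rw [Finset.sum_eq_zero fun i hi => h i hi fun e => hD (e ▸ hi)]
    exact m.zero_le

variable {F : Type u} [Field F] [Fintype F] {n t L : ℕ}

theorem card_polys_le (hL : Fintype.card F ≤ 2 ^ L) :
    Nat.card (Poly F t × Poly F t) ≤ 2 ^ (2 * (t + 1) * L) := by
  rw [Nat.card_prod, Nat.card_fun, Nat.card_eq_fintype_card, Nat.card_eq_fintype_card,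
    Fintype.card_fin, ← pow_add]
  calc _ ≤ (2 ^ L) ^ (t + 1 + (t + 1)) := Nat.pow_le_pow_left hL _
    _ = _ := by rw [← pow_mul]; congr 1; ring

theorem card_option_le {M : Type u} [Finite M] {m : ℕ} (h : Nat.card M ≤ 2 ^ m) :
    Nat.card (Option M) ≤ 2 ^ (m + 1) := by
  have := Nat.one_le_two_pow (n := m)
  rw [Finite.card_option, pow_succ]
  omega

theorem card_fun_le {M : Type u} {m : ℕ} (n : ℕ) (h : Nat.card M ≤ 2 ^ m) :
    Nat.card (Fin n → M) ≤ 2 ^ (m * n) := by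
  rw [Nat.card_fun, Nat.card_fin, pow_mul]
  exact Nat.pow_le_pow_left h n

variable [DecidableEq F] {α : Fin n → F} {D : Fin n} {C : Finset (Fin n)}

theorem sharing_privBits_le (hL : Fintype.card F ≤ 2 ^ L) (A : (sharing α t D).Strategy C)
    (x : Fin n → Option F) (c : Fin n → ShCoins F t) :
    (sharing α t D).privBits C ((sharing α t D).exec C A x c) ≤
      n * (2 * (t + 1) * L + 1) + n * (n * (L + 1)) := by
  have hs := fun r i hi => sharing_exec_of_notMem α D C A x c r (i := i) hi
  have h : ∀ r : Fin 7, ∑ i ∈ Cᶜ, ∑ j,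
      (if (((sharing α t D).exec C A x c r i).priv j).isSome then msgBits (ShP F t r) else 0) ≤
      -- Budget per round: `n` pairs of polynomials from the dealer, then `n * n` field elements.
      (![n * (2 * (t + 1) * L + 1), n * (n * (L + 1)), 0, 0, 0, 0, 0] : Fin 7 → ℕ) r := by
    have hz : ∀ r : Fin 7, (∀ i, i ∉ C → ∀ j,
        ((sharing α t D).exec C A x c r i).priv j = none) → ∑ i ∈ Cᶜ, ∑ j,
        (if (((sharing α t D).exec C A x c r i).priv j).isSome then msgBits (ShP F t r) else 0)
          ≤ 0 := by
      intro r hr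
      refine (Finset.sum_eq_zero fun i hi => Finset.sum_eq_zero fun j _ => ?_).le
      rw [hr i (Finset.mem_compl.1 hi) j]
      rfl
    intro r
    match r with
    | 0 =>
      refine sum_le_of_eq_zero _ D (fun i hi hiD => Finset.sum_eq_zero fun j _ => ?_) fun _ => ?_
      · rw [hs 0 i (Finset.mem_compl.1 hi)]
        simp [shSend, hiD]
      · exact (sum_ite_le_card_mul _ _ _).trans
          (Nat.mul_le_mul_left n (msgBits_le (card_polys_le hL)))
    | 1 =>
      have hm : msgBits (ShP F t 1) ≤ L + 1 :=
        msgBits_le (by rw [Nat.card_eq_fintype_card]; exact hL)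
      calc _ ≤ ∑ i ∈ Cᶜ, n * (L + 1) := Finset.sum_le_sum fun i _ =>
            (sum_ite_le_card_mul _ _ _).trans (Nat.mul_le_mul_left n hm)
        _ ≤ _ := by
          rw [Finset.sum_const, smul_eq_mul]
          exact Nat.mul_le_mul_right _ ((Finset.card_le_univ _).trans (by simp))
    | 2 => exact hz 2 fun i hi j => by rw [hs 2 i hi]; rfl
    | 3 => exact hz 3 fun i hi j => by rw [hs 3 i hi]; rfl
    | 4 => exact hz 4 fun i hi j => by rw [hs 4 i hi]; rfl
    | 5 => exact hz 5 fun i hi j => by rw [hs 5 i hi]; rfl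
    | 6 => exact hz 6 fun i hi j => by rw [hs 6 i hi]; rfl
  refine (Finset.sum_le_sum fun r _ => h r).trans ?_
  simp [Fin.sum_univ_succ]

theorem sharing_bcBits_le (hL : Fintype.card F ≤ 2 ^ L) (A : (sharing α t D).Strategy C)
    (x : Fin n → Option F) (c : Fin n → ShCoins F t) :
    (sharing α t D).bcBits C ((sharing α t D).exec C A x c) ≤
      n * (n + 1) + ((L + 1) * n * n + 1) + n + ((2 * (t + 1) * L + 1) * n + 1) + n := by
  have hs := fun r i hi => sharing_exec_of_notMem α D C A x c r (i := i) hi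
  have h : ∀ r : Fin 7, ∑ i ∈ Cᶜ,
      (if ((sharing α t D).exec C A x c r i).bc.isSome then msgBits (ShB F n t r) else 0) ≤
      -- Complaint-lists are `n`-bit subsets; optional entries of the dealer's tables cost one extra
      -- bit each; an accusation costs one bit.
      (![0, 0, n * (n + 1), (L + 1) * n * n + 1, n * 1, (2 * (t + 1) * L + 1) * n + 1, n * 1] :
        Fin 7 → ℕ) r := by
    have hunit : msgBits PUnit.{u + 1} ≤ 1 := msgBits_le (m := 0) (by simp)
    have hz : ∀ r : Fin 7, (∀ i, i ∉ C →
        ((sharing α t D).exec C A x c r i).bc = none) → ∑ i ∈ Cᶜ,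
        (if ((sharing α t D).exec C A x c r i).bc.isSome then msgBits (ShB F n t r) else 0)
          ≤ 0 := by
      intro r hr
      refine (Finset.sum_eq_zero fun i hi => ?_).le
      rw [hr i (Finset.mem_compl.1 hi)]
      rfl
    have hd : ∀ (r : Fin 7) (m : ℕ), msgBits (ShB F n t r) ≤ m →
        (∀ i, i ∉ C → i ≠ D → ((sharing α t D).exec C A x c r i).bc = none) → ∑ i ∈ Cᶜ,
        (if ((sharing α t D).exec C A x c r i).bc.isSome then msgBits (ShB F n t r) else 0)
          ≤ m := by
      intro r m hm hr
      refine sum_le_of_eq_zero _ D (fun i hi hiD => ?_) fun _ => ?_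
      · rw [hr i (Finset.mem_compl.1 hi) hiD]
        rfl
      · split_ifs
        · exact hm
        · exact m.zero_le
    intro r
    match r with
    | 0 => exact hz 0 fun i hi => by rw [hs 0 i hi]; rfl
    | 1 => exact hz 1 fun i hi => by rw [hs 1 i hi]; rfl
    | 2 =>
      refine (sum_ite_le_card_mul _ _ _).trans (Nat.mul_le_mul_left n (msgBits_le ?_))
      change Nat.card (ULift (Finset (Fin n))) ≤ _
      simp
    | 3 =>
      refine hd 3 _ (msgBits_le (card_fun_le n (card_fun_le n (card_option_le ?_))))
        fun i hi hiD => by rw [hs 3 i hi]; simp [shSend, hiD]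
      rw [Nat.card_eq_fintype_card]
      exact hL
    | 4 => exact (sum_ite_le_card_mul _ _ _).trans (Nat.mul_le_mul_left n hunit)
    | 5 =>
      exact hd 5 _ (msgBits_le (card_fun_le n (card_option_le (card_polys_le hL))))
        fun i hi hiD => by rw [hs 5 i hi]; simp [shSend, hiD]
    | 6 => exact (sum_ite_le_card_mul _ _ _).trans (Nat.mul_le_mul_left n hunit)
  refine (Finset.sum_le_sum fun r _ => h r).trans ?_
  simp [Fin.sum_univ_succ]
  omega

theorem reconstruction_privBits_le (hL : Fintype.card F ≤ 2 ^ L)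
    (τ : (reconstruction α t D).Transcript) :
    (reconstruction α t D).privBits C τ ≤ n * (n * (L + 1)) := by
  have hm : msgBits F ≤ L + 1 := msgBits_le (by rw [Nat.card_eq_fintype_card]; exact hL)
  refine (Finset.sum_le_sum (g := fun _ : Fin 1 => n * (n * (L + 1))) fun r _ => ?_).trans
    (by simp)
  calc _ ≤ ∑ i ∈ Cᶜ, n * (L + 1) := Finset.sum_le_sum fun i _ =>
        (sum_ite_le_card_mul _ _ _).trans (Nat.mul_le_mul_left n hm)
    _ ≤ _ := by
      rw [Finset.sum_const, smul_eq_mul]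
      exact Nat.mul_le_mul_right _ ((Finset.card_le_univ _).trans (by simp))

theorem reconstruction_bcBits_eq_zero (τ : (reconstruction α t D).Transcript) :
    (reconstruction α t D).bcBits C τ = 0 := by
  refine Finset.sum_eq_zero fun r _ => Finset.sum_eq_zero fun i _ => ?_
  have : (τ r i).bc = none := by
    cases h : (τ r i).bc with
    | none => rfl
    | some b => exact PEmpty.elim b
  simp [this]

end

end BGW

theorem mainTheorem1 :
    ∃ K : ℝ, ∀ (F : Type u) [Field F] [Fintype F] [DecidableEq F] (n t : ℕ) (α : Fin n → F)
      (D : Fin n), 3 * t < n → Function.Injective α → (∀ i, α i ≠ 0) →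
      ((BGW.scheme α t D).sh.rounds = 7 ∧ (BGW.scheme α t D).recon.rounds = 1) ∧
      (BGW.scheme α t D).IsTypeII D t (BGW.shamir α t) ∧
      BGW.CommitsToBivariate α t D ∧
      ∀ C : Finset (Fin n), C.card ≤ t →
        ∀ (s : F) (c : Fin n → (BGW.scheme α t D).sh.Coins) (A : (BGW.scheme α t D).sh.Strategy C)
          (c' : Fin n → (BGW.scheme α t D).recon.Coins)
          (A' : (BGW.scheme α t D).recon.Strategy C),
          let V := BGW.scheme α t D
          let τ := V.sh.exec C A (VSSScheme.inputs D s) c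
          let τ' := V.recon.exec C A' (V.sh.finalView C A (VSSScheme.inputs D s) c) c'
          ((V.sh.privBits C τ + V.recon.privBits C τ' : ℕ) : ℝ) ≤
              K * (n : ℝ) ^ 2 * Real.logb 2 (Fintype.card F) ∧
          ((V.sh.bcBits C τ + V.recon.bcBits C τ' : ℕ) : ℝ) ≤
              K * (n : ℝ) ^ 2 * Real.logb 2 (Fintype.card F) := by
  -- `22 = 11 * 2`: the broadcast bound is at most `11 * (n * n * L)`, the private one is smaller,
  -- and `L` is at most twice the logarithm because a field has at least two elements.
  refine ⟨22, fun F _ _ _ n t α D hn hα h0 => ⟨⟨rfl, rfl⟩,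
    ⟨BGW.shamir_isThreshold hα h0 t, BGW.scheme_privacy hα h0, BGW.scheme_correctness hα hn,
      BGW.scheme_strongCommitment hα hn⟩, BGW.scheme_commitsToBivariate hα hn, ?_⟩⟩
  intro C _ s c A c' A' V τ τ'
  set L := Nat.log 2 (Fintype.card F) + 1 with hLdef
  have hL : Fintype.card F ≤ 2 ^ L := (Nat.lt_pow_succ_log_self one_lt_two _).le
  have hlog1 : 1 ≤ Nat.log 2 (Fintype.card F) :=
    Nat.log_pos one_lt_two Fintype.one_lt_card
  have hlog : (L : ℝ) ≤ 2 * Real.logb 2 (Fintype.card F) := by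
    have h1 : (Nat.log 2 (Fintype.card F) : ℝ) ≤ Real.logb 2 (Fintype.card F) := by
      exact_mod_cast Real.natLog_le_logb (Fintype.card F) 2
    have h2 : L ≤ 2 * Nat.log 2 (Fintype.card F) := by omega
    have h3 : (L : ℝ) ≤ 2 * (Nat.log 2 (Fintype.card F) : ℝ) := by exact_mod_cast h2
    linarith
  have hL1 : 1 ≤ L := by omega
  have hn1 : 1 ≤ n := by omega
  -- Here `t + 1 ≤ n` makes `n` polynomials of degree `t` cost no more than `n * n` field elements.
  have ht : (t + 1) * L * n ≤ n * n * L := by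
    calc (t + 1) * L * n ≤ n * L * n := by gcongr; omega
      _ = n * n * L := by ring
  have hnn : n ≤ n * n := Nat.le_mul_of_pos_left n hn1
  have hnL : n * n ≤ n * n * L := Nat.le_mul_of_pos_right _ hL1
  have fin : ∀ m : ℕ, m ≤ 11 * (n * n * L) →
      (m : ℝ) ≤ 22 * (n : ℝ) ^ 2 * Real.logb 2 (Fintype.card F) := by
    intro m hm
    calc (m : ℝ) ≤ 11 * ((n : ℝ) * n * L) := by exact_mod_cast hm
      _ ≤ 11 * ((n : ℝ) * n * (2 * Real.logb 2 (Fintype.card F))) := by gcongr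
      _ = _ := by ring
  constructor
  · refine fin _ ((Nat.add_le_add (BGW.sharing_privBits_le hL A _ c)
      (BGW.reconstruction_privBits_le hL τ')).trans ?_)
    nlinarith
  · rw [BGW.reconstruction_bcBits_eq_zero τ', add_zero]
    refine fin _ ((BGW.sharing_bcBits_le hL A _ c).trans ?_)
    nlinarith
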